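/- Let $(X,\pi_X)$ be a Poisson manifold, let $p:E\to X$ be a surjective submersion of smooth finite-dimensional manifolds, and let $\sigma$ be a closed two-form on $E$. Write $\sigma^\sharp(U)=\sigma(U,\cdot)$ and $\pi^\sharp(\xi)=\pi(\xi,\cdot)$. Assume that the Dirac structure $p^*(L_{\pi_X})^\sigma=\{U+p^*\eta+\sigma^\sharp(U) : p_*U=\pi_X^\sharp(\eta)\}\subset TE\oplus T^*E$ is the graph $\{\pi^\sharp\xi+\xi : \xi\in T^*E\}$ of a Poisson structure $\pi=\pi_X^\sigma$ on $E$. Let $T^*X$ and $T^*E$ be the cotangent Lie algebroids of $\pi_X$ and $\pi_X^\sigma$ (the anchor is $\pi^\sharp$ and $[\xi,\eta]=L_{\pi^\sharp\xi}\eta-L_{\pi^\sharp\eta}\xi-d(\pi(\xi,\eta))$). Let $TE\times_{TX}T^*X=\{(U,\eta) : p_*U=\pi_X^\sharp(\eta)\}$ be the pullback Lie algebroid of $T^*X$ along $p$: its anchor is $(U,\eta)\mapsto U$, and its bracket is the bracket of vector fields in the first component, while in the second component it is $$\Big[\big(U,\textstyle\sum_i f_i\,\alpha_i\circ p\big),\big(V,\sum_j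 g_j\,\beta_j\circ p\big)\Big]_2=\sum_{i,j} f_ig_j\,[\alpha_i,\beta_j]\circ p+\sum_j U(g_j)\,\beta_j\circ p-\sum_i V(f_i)\,\alpha_i\circ p .$$ Let $\mathbb V=\ker p_*\subset TE$, with the bracket of vector fields. These Lie algebroids exist, and they have the following properties. 1. The map $\sigma^\sharp+p^*:TE\times_{TX}T^*X\to T^*E$, $(U,\eta)\mapsto\sigma^\sharp(U)+p^*(\eta)$, is an isomorphism of Lie algebroids over $E$. 2. The sequence $0\to\mathbb V\to TE\times_{TX}T^*X\to T^*X\to 0$, with maps $v\mapsto(v,0)$ and $(U,\eta)\mapsto\eta$ (the latter covering $p$), is a short exact sequence of Lie algebroids. For every $\xi\in T_e^*E$ there is a unique $q(\xi)\in T^*_{p(e)}X$ with $p^*(q(\xi))=\xi-\sigma^\sharp\big((\pi_X^\sigma)^\sharp(\xi)\big)$. The sequence $0\to\mathbb V\xrightarrow{\sigma^\sharp}T^*E\xrightarrow{q}T^*X\to0$ is also a short exact sequence of Lie algebroids. The isomorphism of part 1 carries the first sequence to the second: $(\sigma^\sharp+p^*)(v,0)=\sigma^\sharp(v)$ for $v\in\mathbb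 V$, and $q(\sigma^\sharp(U)+p^*\eta)=\eta$. -/

import Mathlib

open Bundle
open scoped Manifold ContDiff

set_option synthInstance.maxHeartbeats 200000

namespace PoissonGeometry

noncomputable section

/-! ### Vector fields, one-forms, two-forms -/

section Forms

variable (V : Type*) [NormedAddCommGroup V] [NormedSpace ℝ V]

/-- The cotangent space `T*ₓM` of a manifold `M` modelled on `V`. -/
abbrev Cotangent {M : Type*} [TopologicalSpace M] [ChartedSpace V M] (x : M) : Type _ :=
  TangentSpace 𝓘(ℝ, V) x →L[ℝ] ℝ

variable (M : Type*) [TopologicalSpace M] [ChartedSpace V M] [IsManifold 𝓘(ℝ, V) ∞ M]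

/-- Smooth vector fields on `M`. -/
abbrev SmoothVectorField : Type _ :=
  Cₛ^∞⟮𝓘(ℝ, V); V, (fun x : M => TangentSpace 𝓘(ℝ, V) x)⟯

/-- Smooth two-forms on `M`. -/
structure TwoForm where
  form : Cₛ^∞⟮𝓘(ℝ, V); V →L[ℝ] V →L[ℝ] ℝ,
    (fun x : M => TangentSpace 𝓘(ℝ, V) x →L[ℝ] TangentSpace 𝓘(ℝ, V) x →L[ℝ] ℝ)⟯
  alternating : ∀ (x : M) (v : TangentSpace 𝓘(ℝ, V) x), form x v v = 0

variable {V M}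

/-- `σ♯ : TₓM → T*ₓM`, `σ♯(U) = σ(U, ·)`. -/
def TwoForm.sharp (σ : TwoForm V M) (x : M) : TangentSpace 𝓘(ℝ, V) x →L[ℝ] Cotangent V x :=
  σ.form x

/-- `dσ = 0`, by the invariant formula for the exterior derivative. -/
def TwoForm.Closed (σ : TwoForm V M) : Prop :=
  ∀ (X Y Z : SmoothVectorField V M) (x : M),
    mvfderiv 𝓘(ℝ, V) (fun y => σ.form y (Y y) (Z y)) x (X x)
      + mvfderiv 𝓘(ℝ, V) (fun y => σ.form y (Z y) (X y)) x (Y x)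
      + mvfderiv 𝓘(ℝ, V) (fun y => σ.form y (X y) (Y y)) x (Z x)
      - σ.form x (VectorField.mlieBracket 𝓘(ℝ, V) X Y x) (Z x)
      - σ.form x (VectorField.mlieBracket 𝓘(ℝ, V) Y Z x) (X x)
      - σ.form x (VectorField.mlieBracket 𝓘(ℝ, V) Z X x) (Y x) = 0

/-- `(L_X η)(Y) = X(η(Y)) - η([X, Y])`: the Lie derivative of the one-form `η` along `X`,
evaluated on the vector field `Y`. -/
def lieDerivOneForm (X : Π x : M, TangentSpace 𝓘(ℝ, V) x) (η : Π x : M, Cotangent V x)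
    (Y : Π x : M, TangentSpace 𝓘(ℝ, V) x) (x : M) : ℝ :=
  mvfderiv 𝓘(ℝ, V) (fun y => η y (Y y)) x (X x) - η x (VectorField.mlieBracket 𝓘(ℝ, V) X Y x)

variable (V M)

/-- A Poisson structure on `M`. The bivector field `π` is recorded through the smooth bundle map
`π♯ : T*M → TM`, with `π(ξ, η) = η(π♯ ξ)`; the bracket `{f, g} = π(df, dg)` satisfies the
Jacobi identity. -/
structure PoissonStructure where
  sharp : Cₛ^∞⟮𝓘(ℝ, V); (V →L[ℝ] ℝ) →L[ℝ] V,
    (fun x : M => (TangentSpace 𝓘(ℝ, V) x →L[ℝ] ℝ) →L[ℝ] TangentSpace 𝓘(ℝ, V) x)⟯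
  skew : ∀ (x : M) (ξ η : Cotangent V x), η (sharp x ξ) = - ξ (sharp x η)
  jacobi : ∀ f g h : M → ℝ, ContMDiff 𝓘(ℝ, V) 𝓘(ℝ, ℝ) ∞ f → ContMDiff 𝓘(ℝ, V) 𝓘(ℝ, ℝ) ∞ g →
    ContMDiff 𝓘(ℝ, V) 𝓘(ℝ, ℝ) ∞ h →
    let br : (M → ℝ) → (M → ℝ) → M → ℝ := fun a b x =>
      mvfderiv 𝓘(ℝ, V) b x (sharp x (mvfderiv 𝓘(ℝ, V) a x))
    ∀ x, br f (br g h) x + br g (br h f) x + br h (br f g) x = 0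

end Forms

/-! ### Dirac structures, as families of subspaces of `TM ⊕ T*M` -/

section Dirac

variable {V : Type*} [NormedAddCommGroup V] [NormedSpace ℝ V]
  {M : Type*} [TopologicalSpace M] [ChartedSpace V M]
  {W : Type*} [NormedAddCommGroup W] [NormedSpace ℝ W]
  {N : Type*} [TopologicalSpace N] [ChartedSpace W N]

/-- `p^* : T*_{p e}N → T*_e M`. -/
def pullbackCovector (p : M → N) (e : M) : Cotangent W (p e) →ₗ[ℝ] Cotangent V e where
  toFun η := η.comp (mfderiv 𝓘(ℝ, V) 𝓘(ℝ, W) p e)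
  map_add' _ _ := ContinuousLinearMap.add_comp _ _ _
  map_smul' _ _ := ContinuousLinearMap.smul_comp _ _ _

/-- The graph `L_π = {π♯ ξ + ξ}` of a Poisson structure. -/
def PoissonStructure.graph [IsManifold 𝓘(ℝ, V) ∞ M] (ϖ : PoissonStructure V M) (x : M) :
    Submodule ℝ (TangentSpace 𝓘(ℝ, V) x × Cotangent V x) :=
  LinearMap.range ((ϖ.sharp x : Cotangent V x →ₗ[ℝ] TangentSpace 𝓘(ℝ, V) x).prod LinearMap.id)

/-- The pullback `p^*(L) = {U + p^*η : p_* U + η ∈ L}`. -/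
def pullbackDirac (p : M → N)
    (L : Π x : N, Submodule ℝ (TangentSpace 𝓘(ℝ, W) x × Cotangent W x)) (e : M) :
    Submodule ℝ (TangentSpace 𝓘(ℝ, V) e × Cotangent V e) :=
  ((L (p e)).comap
      ((mfderiv 𝓘(ℝ, V) 𝓘(ℝ, W) p e : TangentSpace 𝓘(ℝ, V) e →ₗ[ℝ] TangentSpace 𝓘(ℝ, W) (p e)).prodMap
        (LinearMap.id : Cotangent W (p e) →ₗ[ℝ] Cotangent W (p e)))).map
    ((LinearMap.id : TangentSpace 𝓘(ℝ, V) e →ₗ[ℝ] TangentSpace 𝓘(ℝ, V) e).prodMap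
      (pullbackCovector (V := V) (W := W) p e))

/-- The gauge transformation `L^σ = {U + ξ + σ♯(U) : U + ξ ∈ L}`. -/
def gaugeDirac [IsManifold 𝓘(ℝ, V) ∞ M] (σ : TwoForm V M)
    (L : Π x : M, Submodule ℝ (TangentSpace 𝓘(ℝ, V) x × Cotangent V x)) (x : M) :
    Submodule ℝ (TangentSpace 𝓘(ℝ, V) x × Cotangent V x) :=
  (L x).map ((LinearMap.fst ℝ _ _).prod
    (LinearMap.snd ℝ _ _ +
      (σ.sharp x : TangentSpace 𝓘(ℝ, V) x →ₗ[ℝ] Cotangent V x).comp (LinearMap.fst ℝ _ _)))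

end Dirac

/-! ### Lie algebroids

A vector bundle over `M` is presented as a smooth subbundle `S` of an ambient smooth vector bundle
`B → M` (with `S = ⊤` for `B` itself). -/

section LieAlgebroids

variable {V : Type*} [NormedAddCommGroup V] [NormedSpace ℝ V]
  {M : Type*} [TopologicalSpace M] [ChartedSpace V M] [IsManifold 𝓘(ℝ, V) ∞ M]
  {F : Type*} [NormedAddCommGroup F] [NormedSpace ℝ F]
  {B : M → Type*} [TopologicalSpace (TotalSpace F B)] [∀ x, AddCommGroup (B x)]
  [∀ x, Module ℝ (B x)] [∀ x, TopologicalSpace (B x)] [FiberBundle F B] [VectorBundle ℝ F B]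

variable (V F) in
/-- The smooth sections of `B` with values in `S`. -/
def sections (S : Π x, Submodule ℝ (B x)) : Submodule ℝ Cₛ^∞⟮𝓘(ℝ, V); F, B⟯ where
  carrier := {s | ∀ x, s x ∈ S x}
  add_mem' hs ht x := (S x).add_mem (hs x) (ht x)
  zero_mem' x := (S x).zero_mem
  smul_mem' c _ hs x := (S x).smul_mem c (hs x)

/-- The value of a section of `S` at a point, as an element of the fibre. -/
def secAt {S : Π x, Submodule ℝ (B x)} (s : sections V F S) (x : M) : S x :=
  ⟨s.1 x, s.2 x⟩

variable (V F) in
/-- `S` is a smooth vector subbundle of `B`: it has smooth local frames. -/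
def IsSmoothSubbundle (S : Π x, Submodule ℝ (B x)) : Prop :=
  ∀ x₀ : M, ∃ O : Set M, IsOpen O ∧ x₀ ∈ O ∧ ∃ (k : ℕ) (b : Fin k → Π x, B x),
    (∀ i, ContMDiffOn 𝓘(ℝ, V) (𝓘(ℝ, V).prod 𝓘(ℝ, F)) ∞
      (fun x => TotalSpace.mk' F x (b i x)) O) ∧
    ∀ x ∈ O, LinearIndependent ℝ (fun i => b i x) ∧
      Submodule.span ℝ (Set.range fun i => b i x) = S x

variable (V F) in
/-- A Lie algebroid structure on the vector bundle `S`. -/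
structure LieAlgebroid (S : Π x, Submodule ℝ (B x)) where
  subbundle : IsSmoothSubbundle V F S
  anchor : Π x, S x →ₗ[ℝ] TangentSpace 𝓘(ℝ, V) x
  anchor_smooth : ∀ s : sections V F S,
    ContMDiff 𝓘(ℝ, V) (𝓘(ℝ, V).prod 𝓘(ℝ, V)) ∞
      (fun x => (TotalSpace.mk' V x (anchor x (secAt s x)) : TangentBundle 𝓘(ℝ, V) M))
  bracket : sections V F S →ₗ[ℝ] sections V F S →ₗ[ℝ] sections V F S
  bracket_self : ∀ s, bracket s s = 0
  jacobi : ∀ r s t, bracket r (bracket s t) + bracket s (bracket t r) + bracket t (bracket r s) = 0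
  leibniz : ∀ (f : M → ℝ), ContMDiff 𝓘(ℝ, V) 𝓘(ℝ, ℝ) ∞ f → ∀ s t ft : sections V F S,
    (∀ x, secAt ft x = f x • secAt t x) →
    ∀ x, secAt (bracket s ft) x =
      f x • secAt (bracket s t) x + mvfderiv 𝓘(ℝ, V) f x (anchor x (secAt s x)) • secAt t x
  anchor_bracket : ∀ (s t : sections V F S) (x : M),
    anchor x (secAt (bracket s t) x) = VectorField.mlieBracket 𝓘(ℝ, V)
      (fun y => anchor y (secAt s y)) (fun y => anchor y (secAt t y)) x

variable {F' : Type*} [NormedAddCommGroup F'] [NormedSpace ℝ F']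
  {B' : M → Type*} [TopologicalSpace (TotalSpace F' B')] [∀ x, AddCommGroup (B' x)]
  [∀ x, Module ℝ (B' x)] [∀ x, TopologicalSpace (B' x)] [FiberBundle F' B'] [VectorBundle ℝ F' B']

/-- Lie algebroid morphisms over the identity of `M`. -/
structure IsLieAlgebroidHom {S : Π x, Submodule ℝ (B x)} {S' : Π x, Submodule ℝ (B' x)}
    (A : LieAlgebroid V F S) (A' : LieAlgebroid V F' S') (φ : Π x, S x →ₗ[ℝ] S' x) : Prop where
  smooth : ∀ s : sections V F S, ContMDiff 𝓘(ℝ, V) (𝓘(ℝ, V).prod 𝓘(ℝ, F')) ∞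
    (fun x => TotalSpace.mk' F' x (φ x (secAt s x) : B' x))
  anchor : ∀ x u, A'.anchor x (φ x u) = A.anchor x u
  bracket : ∀ (s t : sections V F S) (s' t' : sections V F' S'),
    (∀ x, secAt s' x = φ x (secAt s x)) → (∀ x, secAt t' x = φ x (secAt t x)) →
    ∀ x, secAt (A'.bracket s' t') x = φ x (secAt (A.bracket s t) x)

/-- Lie algebroid isomorphisms over the identity of `M`. -/
def IsLieAlgebroidIso {S : Π x, Submodule ℝ (B x)} {S' : Π x, Submodule ℝ (B' x)}
    (A : LieAlgebroid V F S) (A' : LieAlgebroid V F' S') (φ : Π x, S x →ₗ[ℝ] S' x) : Prop :=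
  IsLieAlgebroidHom A A' φ ∧ ∃ ψ : Π x, S' x →ₗ[ℝ] S x,
    (∀ x u, ψ x (φ x u) = u) ∧ (∀ x u, φ x (ψ x u) = u) ∧ IsLieAlgebroidHom A' A ψ

variable {W : Type*} [NormedAddCommGroup W] [NormedSpace ℝ W]
  {N : Type*} [TopologicalSpace N] [ChartedSpace W N] [IsManifold 𝓘(ℝ, W) ∞ N]
  {G : Type*} [NormedAddCommGroup G] [NormedSpace ℝ G]
  {C : N → Type*} [TopologicalSpace (TotalSpace G C)] [∀ x, AddCommGroup (C x)]
  [∀ x, Module ℝ (C x)] [∀ x, TopologicalSpace (C x)] [FiberBundle G C] [VectorBundle ℝ G C]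

/-- The bracket rule over `p : M → N` of Higgins and Mackenzie. Let `a`, `b`, `c` be sections of the
pullback bundle `p^*D` of a Lie algebroid `D → N` and `X`, `Y` vector fields on `M`. Whenever
`a = ∑ fᵢ αᵢ∘p` and `b = ∑ gⱼ βⱼ∘p` on an open set, with functions `fᵢ`, `gⱼ` and sections
`αᵢ`, `βⱼ` of `D`, one has there
`c = ∑ fᵢ gⱼ [αᵢ, βⱼ]∘p + ∑ X(gⱼ) βⱼ∘p - ∑ Y(fᵢ) αᵢ∘p`. -/
def BracketRule (p : M → N) {S : Π x, Submodule ℝ (C x)} (D : LieAlgebroid W G S)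
    (X Y : Π e : M, TangentSpace 𝓘(ℝ, V) e) (a b c : Π e : M, C (p e)) : Prop :=
  ∀ O : Set M, IsOpen O → ∀ (m n : ℕ) (f : Fin m → M → ℝ) (g : Fin n → M → ℝ)
    (α : Fin m → sections W G S) (β : Fin n → sections W G S),
    (∀ i, ContMDiffOn 𝓘(ℝ, V) 𝓘(ℝ, ℝ) ∞ (f i) O) →
    (∀ j, ContMDiffOn 𝓘(ℝ, V) 𝓘(ℝ, ℝ) ∞ (g j) O) →
    (∀ e ∈ O, a e = ∑ i, f i e • (secAt (α i) (p e) : C (p e))) →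
    (∀ e ∈ O, b e = ∑ j, g j e • (secAt (β j) (p e) : C (p e))) →
    ∀ e ∈ O, c e =
      ∑ i, ∑ j, (f i e * g j e) • (secAt (D.bracket (α i) (β j)) (p e) : C (p e))
      + ∑ j, mvfderiv 𝓘(ℝ, V) (g j) e (X e) • (secAt (β j) (p e) : C (p e))
      - ∑ i, mvfderiv 𝓘(ℝ, V) (f i) e (Y e) • (secAt (α i) (p e) : C (p e))

/-- Lie algebroid morphisms over a map `p : M → N`. -/
structure IsLieAlgebroidHomOver (p : M → N) {S : Π x, Submodule ℝ (B x)}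
    {S' : Π x, Submodule ℝ (C x)} (A : LieAlgebroid V F S) (D : LieAlgebroid W G S')
    (φ : Π e, S e →ₗ[ℝ] S' (p e)) : Prop where
  smooth : ∀ s : sections V F S, ContMDiff 𝓘(ℝ, V) (𝓘(ℝ, W).prod 𝓘(ℝ, G)) ∞
    (fun e => TotalSpace.mk' G (p e) (φ e (secAt s e) : C (p e)))
  anchor : ∀ e u, D.anchor (p e) (φ e u) = mfderiv 𝓘(ℝ, V) 𝓘(ℝ, W) p e (A.anchor e u)
  bracket : ∀ s t : sections V F S, BracketRule p D
    (fun e => A.anchor e (secAt s e)) (fun e => A.anchor e (secAt t e))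
    (fun e => (φ e (secAt s e) : C (p e))) (fun e => (φ e (secAt t e) : C (p e)))
    (fun e => (φ e (secAt (A.bracket s t) e) : C (p e)))

/-- `0 → A → A' → D → 0` is a short exact sequence of Lie algebroids, where `A`, `A'` live over `M`,
`D` lives over `N`, and the second map covers `p : M → N`. -/
structure IsShortExact (p : M → N) {S : Π x, Submodule ℝ (B x)} {S' : Π x, Submodule ℝ (B' x)}
    {T : Π x, Submodule ℝ (C x)} (A : LieAlgebroid V F S) (A' : LieAlgebroid V F' S')
    (D : LieAlgebroid W G T) (i : Π e, S e →ₗ[ℝ] S' e) (j : Π e, S' e →ₗ[ℝ] T (p e)) : Prop where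
  hom_left : IsLieAlgebroidHom A A' i
  hom_right : IsLieAlgebroidHomOver p A' D j
  injective : ∀ e, Function.Injective (i e)
  exact : ∀ e, Function.Exact (i e) (j e)
  surjective : ∀ e, Function.Surjective (j e)

end LieAlgebroids

/-! ### The cotangent, vertical and pullback Lie algebroids -/

section Cotangent

variable (V : Type*) [NormedAddCommGroup V] [NormedSpace ℝ V]
  (M : Type*) [TopologicalSpace M] [ChartedSpace V M] [IsManifold 𝓘(ℝ, V) ∞ M]

/-- `T*M`, as the full subbundle of itself. -/
abbrev cotangentFiber : Π x : M, Submodule ℝ (Cotangent V x) := fun _ => ⊤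

/-- Lie algebroid structures on the vector bundle `T*M`. -/
abbrev CotangentAlgebroid : Type _ := LieAlgebroid V (V →L[ℝ] ℝ) (cotangentFiber V M)

variable {V M}

/-- `A` is the cotangent Lie algebroid of `π`: the anchor is `π♯` and
`[ξ, η] = L_{π♯ξ} η - L_{π♯η} ξ - d(π(ξ, η))`. -/
structure IsCotangentAlgebroid (ϖ : PoissonStructure V M) (A : CotangentAlgebroid V M) : Prop where
  anchor : ∀ x ξ, A.anchor x ξ = ϖ.sharp x ξ.1
  bracket : ∀ (ξ η : sections V (V →L[ℝ] ℝ) (cotangentFiber V M)) (Y : SmoothVectorField V M)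
    (x : M), (A.bracket ξ η).1 x (Y x) =
      lieDerivOneForm (fun y => ϖ.sharp y (ξ.1 y)) η.1 Y x
      - lieDerivOneForm (fun y => ϖ.sharp y (η.1 y)) ξ.1 Y x
      - mvfderiv 𝓘(ℝ, V) (fun y => η.1 y (ϖ.sharp y (ξ.1 y))) x (Y x)

end Cotangent

section Submersion

variable {V : Type*} [NormedAddCommGroup V] [NormedSpace ℝ V]
  {E : Type*} [TopologicalSpace E] [ChartedSpace V E] [IsManifold 𝓘(ℝ, V) ∞ E]
  {W : Type*} [NormedAddCommGroup W] [NormedSpace ℝ W]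
  {X : Type*} [TopologicalSpace X] [ChartedSpace W X] [IsManifold 𝓘(ℝ, W) ∞ X]

/-- The vertical spaces `𝕍_e = ker (p_*)_e ⊆ T_e E`. -/
def verticalFiber (p : C^∞⟮𝓘(ℝ, V), E; 𝓘(ℝ, W), X⟯) (e : E) :
    Submodule ℝ (TangentSpace 𝓘(ℝ, V) e) :=
  LinearMap.ker (mfderiv 𝓘(ℝ, V) 𝓘(ℝ, W) p e :
    TangentSpace 𝓘(ℝ, V) e →ₗ[ℝ] TangentSpace 𝓘(ℝ, W) (p e))

/-- `A` is the Lie algebroid `𝕍 = ker p_*`, with the inclusion into `TE` as anchor and the bracket of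
vector fields. -/
structure IsVerticalAlgebroid (p : C^∞⟮𝓘(ℝ, V), E; 𝓘(ℝ, W), X⟯)
    (A : LieAlgebroid V V (verticalFiber p)) : Prop where
  anchor : ∀ e v, A.anchor e v = v.1
  bracket : ∀ (s t : sections V V (verticalFiber p)) (e : E),
    (A.bracket s t).1 e = VectorField.mlieBracket 𝓘(ℝ, V) s.1 t.1 e

instance pullbackAddCommGroup {B B' : Type*} (f : B' → B) (E : B → Type*)
    [i : ∀ x, AddCommGroup (E x)] (x : B') : AddCommGroup ((f *ᵖ E) x) :=
  inferInstanceAs (AddCommGroup (E (f x)))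

/-- The vector bundle `TE ⊕ p^*(T*X)` over `E`. -/
abbrev ambientFiber (p : C^∞⟮𝓘(ℝ, V), E; 𝓘(ℝ, W), X⟯) (e : E) : Type _ :=
  TangentSpace 𝓘(ℝ, V) e × (p *ᵖ (fun x : X => Cotangent W x)) e

/-- The component `(U, η) ↦ η` of `TE ⊕ p^*(T*X)`. -/
def ambientSnd (p : C^∞⟮𝓘(ℝ, V), E; 𝓘(ℝ, W), X⟯) (e : E) :
    ambientFiber p e →ₗ[ℝ] Cotangent W (p e) where
  toFun u := u.2
  map_add' _ _ := rfl
  map_smul' _ _ := rfl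

/-- The fibre `{(U, η) ∈ T_e E × T*_{p e} X : p_* U = π♯ η}` of `TE ×_{TX} T*X` at `e`. -/
def pullbackFiber (p : C^∞⟮𝓘(ℝ, V), E; 𝓘(ℝ, W), X⟯) (ϖ : PoissonStructure W X) (e : E) :
    Submodule ℝ (ambientFiber p e) :=
  LinearMap.eqLocus
    ((mfderiv 𝓘(ℝ, V) 𝓘(ℝ, W) p e : TangentSpace 𝓘(ℝ, V) e →ₗ[ℝ] TangentSpace 𝓘(ℝ, W) (p e)).comp
      (LinearMap.fst ℝ _ _))
    ((ϖ.sharp (p e) : Cotangent W (p e) →ₗ[ℝ] TangentSpace 𝓘(ℝ, W) (p e)).comp (ambientSnd p e))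

/-- Lie algebroid structures on the vector bundle `TE ×_{TX} T*X`. -/
abbrev PullbackAlgebroid (p : C^∞⟮𝓘(ℝ, V), E; 𝓘(ℝ, W), X⟯) (ϖ : PoissonStructure W X) : Type _ :=
  LieAlgebroid V (V × (W →L[ℝ] ℝ)) (pullbackFiber p ϖ)

/-- `P` is the pullback to `E` along `p` of the Lie algebroid `A` on `T*X`: the anchor is
`(U, η) ↦ U`, the first component of the bracket is the bracket of vector fields and the second
component is given by the bracket rule over `p`. -/
structure IsPullbackAlgebroid (p : C^∞⟮𝓘(ℝ, V), E; 𝓘(ℝ, W), X⟯) (ϖ : PoissonStructure W X)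
    (A : CotangentAlgebroid W X) (P : PullbackAlgebroid p ϖ) : Prop where
  anchor : ∀ e u, P.anchor e u = u.1.1
  bracket_fst : ∀ (s t : sections V (V × (W →L[ℝ] ℝ)) (pullbackFiber p ϖ)) (e : E),
    ((P.bracket s t).1 e).1 =
      VectorField.mlieBracket 𝓘(ℝ, V) (fun y => (s.1 y).1) (fun y => (t.1 y).1) e
  bracket_snd : ∀ s t : sections V (V × (W →L[ℝ] ℝ)) (pullbackFiber p ϖ),
    BracketRule (C := fun x : X => Cotangent W x) p A
      (fun e => (s.1 e).1) (fun e => (t.1 e).1)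
      (fun e => ambientSnd p e (s.1 e)) (fun e => ambientSnd p e (t.1 e))
      (fun e => ambientSnd p e ((P.bracket s t).1 e))

/-- The map `TE ×_{TX} T*X → T*E`, `(U, η) ↦ σ♯(U) + p^*(η)`. -/
def sharpAddPullback (p : C^∞⟮𝓘(ℝ, V), E; 𝓘(ℝ, W), X⟯) (ϖ : PoissonStructure W X)
    (σ : TwoForm V E) (e : E) : pullbackFiber p ϖ e →ₗ[ℝ] cotangentFiber V E e :=
  LinearMap.codRestrict ⊤
    (((σ.sharp e : TangentSpace 𝓘(ℝ, V) e →ₗ[ℝ] Cotangent V e).comp (LinearMap.fst ℝ _ _)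
      + (pullbackCovector p e).comp (ambientSnd p e)).comp (pullbackFiber p ϖ e).subtype)
    (fun _ => Submodule.mem_top)

/-- The inclusion `𝕍 → TE ×_{TX} T*X`, `v ↦ (v, 0)`. -/
def verticalInclusion (p : C^∞⟮𝓘(ℝ, V), E; 𝓘(ℝ, W), X⟯) (ϖ : PoissonStructure W X) (e : E) :
    verticalFiber p e →ₗ[ℝ] pullbackFiber p ϖ e where
  toFun v := ⟨(v.1, (0 : Cotangent W (p e))),
    (LinearMap.mem_ker.mp v.2).trans (map_zero (ϖ.sharp (p e))).symm⟩
  map_add' _ _ := Subtype.ext (Prod.ext rfl (add_zero (0 : Cotangent W (p e))).symm)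
  map_smul' c _ := Subtype.ext (Prod.ext rfl (smul_zero (A := Cotangent W (p e)) c).symm)

/-- The projection `TE ×_{TX} T*X → T*X`, `(U, η) ↦ η`, over `p`. -/
def pullbackProjection (p : C^∞⟮𝓘(ℝ, V), E; 𝓘(ℝ, W), X⟯) (ϖ : PoissonStructure W X) (e : E) :
    pullbackFiber p ϖ e →ₗ[ℝ] cotangentFiber W X (p e) :=
  LinearMap.codRestrict ⊤ ((ambientSnd p e).comp (pullbackFiber p ϖ e).subtype)
    (fun _ => Submodule.mem_top)

/-- The restriction `σ♯ : 𝕍 → T*E`. -/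
def sharpVertical (p : C^∞⟮𝓘(ℝ, V), E; 𝓘(ℝ, W), X⟯) (σ : TwoForm V E) (e : E) :
    verticalFiber p e →ₗ[ℝ] cotangentFiber V E e where
  toFun v := ⟨σ.sharp e v.1, Submodule.mem_top⟩
  map_add' _ _ := Subtype.ext (map_add (σ.sharp e) _ _)
  map_smul' c _ := Subtype.ext (map_smul (σ.sharp e) c _)

end Submersion

end

end PoissonGeometry

open PoissonGeometry

/-! The hypothesis on Dirac structures is used pointwise. If `p_*U = πX♯ η`, then `U + (σ♯U + p^*η)`
lies in the gauge-transformed Dirac structure, hence in the graph of `πE`, so `πE♯(σ♯U + p^*η) = U`;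
conversely, every covector of `E` arises in this way. So `σ♯ + p^*` is onto; `U` is recovered by
applying `πE♯`, and then `η` because `p^*` is injective for a submersion. Its inverse is `ξ ↦ (πE♯ξ,
q ξ)`. Thus `σ♯ + p^*` is a fibrewise isomorphism that respects anchors (`sharp_sharpAddPullback`,
`sharpAddPullback_bijective`). The inverse preserves smoothness because a submersion has adapted
local frames (`exists_submersion_frame`).

For the brackets, Cartan calculus gives `[ξ, η] = i_{π♯ξ} dη - i_{π♯η} dξ - d(ξ(π♯η))`. Let `ξ = σ♯U
+ ∑ fᵢ p^*αᵢ` and `η = σ♯T + ∑ gⱼ p^*βⱼ` locally, with `U = πE♯ξ` and `T = πE♯η`. The `σ`-terms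
combine to `σ♯[U, T]` because `dσ = 0` (`TwoForm.Closed.extD_contract`). The other terms see `U` and
`T` only through `p_*U = ∑ fᵢ πX♯αᵢ` and `p_*T = ∑ gⱼ πX♯βⱼ`. Since `d` commutes with `p^*`, they
add up to `p^*` of the second component of the pullback bracket (`pair_bracket_of_eventuallyEq`,
`bracket_sharpAddPullback`).

This one formula is used twice. It shows that the algebroid transported from `T*E` along the
isomorphism is the pullback algebroid, which settles existence without checking that the bracket
rule is independent of the chosen expansions. It also shows that `σ♯ + p^*` respects brackets for
any algebroid with the prescribed bracket.

The cotangent algebroid itself rests on `π♯` preserving brackets. The obstruction is a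
function-linear expression in three one-forms, which on exact forms is the Jacobiator up to sign
(`PoissonStructure.anchorDefect_eq_zero`). The first sequence is exact because `(U, 0)` lies in the
fibre product exactly when `U` is vertical and because `p_*` is onto; the second is its image under
the isomorphism. -/

set_option linter.unusedSectionVars false

namespace PoissonGeometry

noncomputable section

open Filter Topology

/-! ### Functions, vector fields and one-forms as algebra -/

section Calculus

variable {V : Type*} [NormedAddCommGroup V] [NormedSpace ℝ V]
  {M : Type*} [TopologicalSpace M] [ChartedSpace V M]

/-- Smooth real functions on `M`. -/
abbrev SmoothFunction (V : Type*) [NormedAddCommGroup V] [NormedSpace ℝ V]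
    (M : Type*) [TopologicalSpace M] [ChartedSpace V M] : Type _ :=
  C^∞⟮𝓘(ℝ, V), M; 𝓘(ℝ, ℝ), ℝ⟯

/-- Smooth one-forms on `M`. -/
abbrev OneForm (V : Type*) [NormedAddCommGroup V] [NormedSpace ℝ V]
    (M : Type*) [TopologicalSpace M] [ChartedSpace V M] [IsManifold 𝓘(ℝ, V) ∞ M] : Type _ :=
  Cₛ^∞⟮𝓘(ℝ, V); V →L[ℝ] ℝ, (fun x : M => Cotangent V x)⟯

omit [ChartedSpace V M] in
theorem contMDiffAt_of_trivial_section [ChartedSpace V M] {f : M → ℝ} {x : M}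
    (h : ContMDiffAt 𝓘(ℝ, V) (𝓘(ℝ, V).prod 𝓘(ℝ, ℝ)) ∞
      (fun y => (TotalSpace.mk' ℝ y (f y) : TotalSpace ℝ (Bundle.Trivial M ℝ))) x) :
    ContMDiffAt 𝓘(ℝ, V) 𝓘(ℝ, ℝ) ∞ f x :=
  (contMDiffAt_section x).1 h

theorem SmoothFunction.mdifferentiableAt (f : SmoothFunction V M) (x : M) :
    MDifferentiableAt 𝓘(ℝ, V) 𝓘(ℝ, ℝ) f x :=
  f.contMDiff.mdifferentiable (by simp) x

variable [IsManifold 𝓘(ℝ, V) ∞ M]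

theorem contMDiffAt_mvfderiv {f : M → ℝ} {x : M} (hf : ContMDiffAt 𝓘(ℝ, V) 𝓘(ℝ, ℝ) ∞ f x) :
    ContMDiffAt 𝓘(ℝ, V) (𝓘(ℝ, V).prod 𝓘(ℝ, V →L[ℝ] ℝ)) ∞
      (fun y => (TotalSpace.mk' (V →L[ℝ] ℝ) y (mvfderiv 𝓘(ℝ, V) f y) :
        TotalSpace (V →L[ℝ] ℝ) (fun x : M => Cotangent V x))) x := by
  rw [contMDiffAt_hom_bundle]
  refine ⟨contMDiffAt_id, ?_⟩
  refine (hf.mfderiv_const (m := ∞) (by simp)).congr_of_eventuallyEq (.of_forall fun y => ?_)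
  ext v
  simp [inTangentCoordinates, ContinuousLinearMap.inCoordinates, mvfderiv]
  rfl

theorem contMDiffAt_pair {α : Π x : M, Cotangent V x} {Y : Π x : M, TangentSpace 𝓘(ℝ, V) x} {x : M}
    (hα : ContMDiffAt 𝓘(ℝ, V) (𝓘(ℝ, V).prod 𝓘(ℝ, V →L[ℝ] ℝ)) ∞
      (fun y => (TotalSpace.mk' (V →L[ℝ] ℝ) y (α y) :
        TotalSpace (V →L[ℝ] ℝ) (fun x : M => Cotangent V x))) x)
    (hY : ContMDiffAt 𝓘(ℝ, V) (𝓘(ℝ, V).prod 𝓘(ℝ, V)) ∞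
      (fun y => (TotalSpace.mk' V y (Y y) : TangentBundle 𝓘(ℝ, V) M)) x) :
    ContMDiffAt 𝓘(ℝ, V) 𝓘(ℝ, ℝ) ∞ (fun y => α y (Y y)) x :=
  contMDiffAt_of_trivial_section
    (ContMDiffAt.clm_bundle_apply (E₂ := Bundle.Trivial M ℝ) (b := fun y => y) hα hY)

/-- The function `α(Y)`. -/
def pair (α : OneForm V M) (Y : SmoothVectorField V M) : SmoothFunction V M :=
  ⟨fun y => α y (Y y), fun x => contMDiffAt_pair (α.contMDiff x) (Y.contMDiff x)⟩

/-- The differential of a smooth function. -/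
def differential (f : SmoothFunction V M) : OneForm V M :=
  ⟨fun y => mvfderiv 𝓘(ℝ, V) f y, fun x => contMDiffAt_mvfderiv (f.contMDiff x)⟩

/-- The derivative of a function along a vector field. -/
def act (X : SmoothVectorField V M) (f : SmoothFunction V M) : SmoothFunction V M :=
  pair (differential f) X

theorem pair_apply (α : OneForm V M) (Y : SmoothVectorField V M) (x : M) :
    pair α Y x = α x (Y x) := rfl

theorem differential_apply (f : SmoothFunction V M) (x : M) :
    differential f x = mvfderiv 𝓘(ℝ, V) f x := rfl

theorem act_apply (X : SmoothVectorField V M) (f : SmoothFunction V M) (x : M) :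
    act X f x = mvfderiv 𝓘(ℝ, V) f x (X x) := rfl

theorem pair_differential (f : SmoothFunction V M) (X : SmoothVectorField V M) :
    pair (differential f) X = act X f := rfl

/-- The product of a smooth function and a smooth section. -/
def fsmul {F : Type*} [NormedAddCommGroup F] [NormedSpace ℝ F]
    {B : M → Type*} [TopologicalSpace (TotalSpace F B)] [∀ x, AddCommGroup (B x)]
    [∀ x, Module ℝ (B x)] [∀ x, TopologicalSpace (B x)] [FiberBundle F B] [VectorBundle ℝ F B]
    (f : SmoothFunction V M) (s : Cₛ^∞⟮𝓘(ℝ, V); F, B⟯) : Cₛ^∞⟮𝓘(ℝ, V); F, B⟯ :=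
  ⟨fun y => f y • s y, f.contMDiff.smul_section s.contMDiff⟩

section fsmul

variable {F : Type*} [NormedAddCommGroup F] [NormedSpace ℝ F]
    {B : M → Type*} [TopologicalSpace (TotalSpace F B)] [∀ x, AddCommGroup (B x)]
    [∀ x, Module ℝ (B x)] [∀ x, TopologicalSpace (B x)] [FiberBundle F B] [VectorBundle ℝ F B]

theorem fsmul_apply (f : SmoothFunction V M) (s : Cₛ^∞⟮𝓘(ℝ, V); F, B⟯) (x : M) :
    fsmul f s x = f x • s x := rfl

theorem section_sum_apply {ι : Type*} (S : Finset ι) (s : ι → Cₛ^∞⟮𝓘(ℝ, V); F, B⟯) (x : M) :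
    (∑ i ∈ S, s i) x = ∑ i ∈ S, s i x := by
  have := map_sum (ContMDiffSection.coeAddHom 𝓘(ℝ, V) F ∞ B) s S
  exact (congrFun this x).trans (Finset.sum_apply x S _)

end fsmul

theorem pair_add_left (α β : OneForm V M) (Y : SmoothVectorField V M) :
    pair (α + β) Y = pair α Y + pair β Y := rfl
theorem pair_neg_left (α : OneForm V M) (Y : SmoothVectorField V M) :
    pair (-α) Y = -pair α Y := rfl
theorem pair_fsmul_left (f : SmoothFunction V M) (α : OneForm V M) (Y : SmoothVectorField V M) :
    pair (fsmul f α) Y = f * pair α Y := rfl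
theorem pair_smul_left (c : ℝ) (α : OneForm V M) (Y : SmoothVectorField V M) :
    pair (c • α) Y = c • pair α Y := rfl
theorem pair_add_right (α : OneForm V M) (Y Z : SmoothVectorField V M) :
    pair α (Y + Z) = pair α Y + pair α Z := by
  ext x; exact map_add (α x) _ _
theorem pair_sub_right (α : OneForm V M) (Y Z : SmoothVectorField V M) :
    pair α (Y - Z) = pair α Y - pair α Z := by
  ext x; exact map_sub (α x) _ _
theorem pair_neg_right (α : OneForm V M) (Y : SmoothVectorField V M) :
    pair α (-Y) = -pair α Y := by
  ext x; exact map_neg (α x) _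
theorem pair_fsmul_right (f : SmoothFunction V M) (α : OneForm V M) (Y : SmoothVectorField V M) :
    pair α (fsmul f Y) = f * pair α Y := by
  ext x; exact map_smul (α x) _ _
theorem pair_smul_right (c : ℝ) (α : OneForm V M) (Y : SmoothVectorField V M) :
    pair α (c • Y) = c • pair α Y := by
  ext x; exact map_smul (α x) _ _

theorem act_add (X : SmoothVectorField V M) (f g : SmoothFunction V M) :
    act X (f + g) = act X f + act X g := by
  ext x
  have := mvfderiv_add (f.mdifferentiableAt x) (g.mdifferentiableAt x)
  exact DFunLike.congr_fun this (X x)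
theorem act_sub (X : SmoothVectorField V M) (f g : SmoothFunction V M) :
    act X (f - g) = act X f - act X g := by
  ext x
  have := mvfderiv_sub (f.mdifferentiableAt x) (g.mdifferentiableAt x)
  exact DFunLike.congr_fun this (X x)
theorem act_neg (X : SmoothVectorField V M) (f : SmoothFunction V M) :
    act X (-f) = -act X f := by
  ext x
  have := mvfderiv_neg (I := 𝓘(ℝ, V)) (g := f) (x := x)
  exact DFunLike.congr_fun this (X x)
theorem act_mul (X : SmoothVectorField V M) (f g : SmoothFunction V M) :
    act X (f * g) = f * act X g + g * act X f := by
  ext x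
  have := mvfderiv_mul (f.mdifferentiableAt x) (g.mdifferentiableAt x)
  exact DFunLike.congr_fun this (X x)
theorem act_smul (X : SmoothVectorField V M) (c : ℝ) (f : SmoothFunction V M) :
    act X (c • f) = c • act X f := by
  ext x
  have := mvfderiv_smul (I := 𝓘(ℝ, V)) (a := fun _ : M => c) mdifferentiableAt_const
    (f.mdifferentiableAt x)
  have h := DFunLike.congr_fun this (X x)
  rw [mvfderiv_const] at h
  simpa using! h

theorem act_add_left (X Y : SmoothVectorField V M) (f : SmoothFunction V M) :
    act (X + Y) f = act X f + act Y f := pair_add_right _ _ _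
theorem act_sub_left (X Y : SmoothVectorField V M) (f : SmoothFunction V M) :
    act (X - Y) f = act X f - act Y f := pair_sub_right _ _ _
theorem act_neg_left (X : SmoothVectorField V M) (f : SmoothFunction V M) :
    act (-X) f = -act X f := pair_neg_right _ _
theorem act_fsmul_left (g : SmoothFunction V M) (X : SmoothVectorField V M)
    (f : SmoothFunction V M) : act (fsmul g X) f = g * act X f := pair_fsmul_right _ _ _
theorem act_smul_left (c : ℝ) (X : SmoothVectorField V M) (f : SmoothFunction V M) :
    act (c • X) f = c • act X f := pair_smul_right _ _ _

end Calculus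

/-! ### The Lie bracket as a commutator of derivations -/

section LieBracketAct

variable {V : Type*} [NormedAddCommGroup V] [NormedSpace ℝ V] [CompleteSpace V]

/-- By the product rule each iterated derivative contains a second derivative of `f` at `(X, Y)`;
these cancel by symmetry and only the derivatives of the fields remain. -/
theorem fderiv_lieBracket_apply {f : V → ℝ} {X Y : V → V} {u : V}
    (hf : ContDiffAt ℝ 2 f u) (hX : DifferentiableAt ℝ X u) (hY : DifferentiableAt ℝ Y u) :
    fderiv ℝ f u (VectorField.lieBracket ℝ X Y u) =
      fderiv ℝ (fun v => fderiv ℝ f v (Y v)) u (X u)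
        - fderiv ℝ (fun v => fderiv ℝ f v (X v)) u (Y u) := by
  have hd : DifferentiableAt ℝ (fderiv ℝ f) u :=
    (hf.fderiv_right (m := 1) (by norm_num)).differentiableAt one_ne_zero
  have hs := hf.isSymmSndFDerivAt (by simp)
  rw [fderiv_clm_apply hd hY, fderiv_clm_apply hd hX]
  simp only [VectorField.lieBracket, map_sub, _root_.add_apply,
    ContinuousLinearMap.comp_apply, ContinuousLinearMap.flip_apply]
  rw [hs (X u) (Y u)]
  ring

variable {M : Type*} [TopologicalSpace M] [ChartedSpace V M] [IsManifold 𝓘(ℝ, V) ∞ M]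

theorem mvfderiv_comp_extChartAt {h : M → ℝ} {h' : V → ℝ} {x y : M}
    (hy : y ∈ (extChartAt 𝓘(ℝ, V) x).source) (heq : h =ᶠ[𝓝 y] h' ∘ extChartAt 𝓘(ℝ, V) x)
    (hd : DifferentiableAt ℝ h' (extChartAt 𝓘(ℝ, V) x y)) (w : TangentSpace 𝓘(ℝ, V) y) :
    mvfderiv 𝓘(ℝ, V) h y w =
      fderiv ℝ h' (extChartAt 𝓘(ℝ, V) x y)
        (mfderiv 𝓘(ℝ, V) 𝓘(ℝ, V) (extChartAt 𝓘(ℝ, V) x) y w) := by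
  have h1 : mfderiv 𝓘(ℝ, V) 𝓘(ℝ, ℝ) h y
      = mfderiv 𝓘(ℝ, V) 𝓘(ℝ, ℝ) (h' ∘ extChartAt 𝓘(ℝ, V) x) y := heq.mfderiv_eq
  have he : MDifferentiableAt 𝓘(ℝ, V) 𝓘(ℝ, V) (extChartAt 𝓘(ℝ, V) x) y :=
    mdifferentiableAt_extChartAt (by simpa using hy)
  rw [mfderiv_comp (I' := 𝓘(ℝ, V)) y hd.mdifferentiableAt he, mfderiv_eq_fderiv] at h1
  exact DFunLike.congr_fun h1 w

/-- Both sides are invariant under diffeomorphism, so the identity is read in the chart at `x`,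
where it is `fderiv_lieBracket_apply`. -/
theorem mvfderiv_mlieBracket (X Y : SmoothVectorField V M) (f : SmoothFunction V M) (x : M) :
    mvfderiv 𝓘(ℝ, V) f x (VectorField.mlieBracket 𝓘(ℝ, V) X Y x) =
      act X (act Y f) x - act Y (act X f) x := by
  set e := extChartAt 𝓘(ℝ, V) x with he
  have hx : x ∈ e.source := mem_extChartAt_source x
  let f' : V → ℝ := f ∘ e.symm
  have hf' : ∀ u ∈ e.target, ContDiffAt ℝ 2 f' u := by
    intro u hu
    have h1 : ContMDiffAt 𝓘(ℝ, V) 𝓘(ℝ, V) ∞ e.symm u :=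
      (contMDiffOn_extChartAt_symm x).contMDiffAt (extChartAt_target_mem_nhds' hu)
    have h2 : ContMDiffAt 𝓘(ℝ, V) 𝓘(ℝ, ℝ) ∞ f' u := f.contMDiff.contMDiffAt.comp u h1
    exact (contMDiffAt_iff_contDiffAt.1 h2).of_le (WithTop.coe_le_coe.2 (le_top : (2 : ℕ∞) ≤ ⊤))
  have hff : ∀ y ∈ e.source, f =ᶠ[𝓝 y] f' ∘ e := by
    intro y hy
    filter_upwards [(isOpen_extChartAt_source x).mem_nhds hy] with z hz
    simp [f', e.left_inv hz]
  -- `P Z` is the expression of `Z` in the chart; the bracket on the manifold is by definition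
  -- pulled back from the bracket of these expressions.
  let P : SmoothVectorField V M → V → V := fun Z =>
    VectorField.mpullbackWithin 𝓘(ℝ, V) 𝓘(ℝ, V) e.symm Z (Set.range 𝓘(ℝ, V))
  have hP : ∀ Z : SmoothVectorField V M, ∀ᶠ y in 𝓝 x,
      P Z (e y) = mfderiv 𝓘(ℝ, V) 𝓘(ℝ, V) e y (Z y) := by
    intro Z
    have h := VectorField.eventuallyEq_mpullback_mpullbackWithin_extChartAt (I := 𝓘(ℝ, V))
      (s := Set.univ) (x := x) Z
    rw [nhdsWithin_univ] at h
    filter_upwards [h, (isOpen_extChartAt_source x).mem_nhds hx] with y hy hys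
    rw [hy]
    exact ((isInvertible_mfderiv_extChartAt hys).self_apply_inverse _).symm
  have hPd : ∀ Z : SmoothVectorField V M, DifferentiableAt ℝ (P Z) (e x) := by
    intro Z
    have h := MDifferentiableWithinAt.differentiableWithinAt_mpullbackWithin_vectorField
      (I := 𝓘(ℝ, V)) (s := Set.univ) (x := x) (V := Z)
      (Z.mdifferentiableAt (x := x)).mdifferentiableWithinAt
    have hset : (extChartAt 𝓘(ℝ, V) x).symm ⁻¹' Set.univ ∩ Set.range 𝓘(ℝ, V) = Set.univ := by simp
    rw [hset] at h
    exact differentiableWithinAt_univ.1 h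
  have hact : ∀ Z : SmoothVectorField V M, ∀ᶠ y in 𝓝 x,
      act Z f y = fderiv ℝ f' (e y) (P Z (e y)) := by
    intro Z
    filter_upwards [hP Z, (isOpen_extChartAt_source x).mem_nhds hx] with y hy hys
    rw [hy]
    exact mvfderiv_comp_extChartAt hys (hff y hys)
      ((hf' _ (e.map_source hys)).differentiableAt (by simp)) _
  -- The outer derivative needs the inner one on a neighbourhood, which is why `hP` and `hact` are
  -- statements about nearby points.
  have hact2 : ∀ Z T : SmoothVectorField V M,
      act Z (act T f) x = fderiv ℝ (fun v => fderiv ℝ f' v (P T v)) (e x) (P Z (e x)) := by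
    intro Z T
    rw [(hP Z).self_of_nhds]
    refine mvfderiv_comp_extChartAt (h' := fun v => fderiv ℝ f' v (P T v)) hx (hact T) ?_ _
    exact DifferentiableAt.clm_apply
      (((hf' _ (e.map_source hx)).fderiv_right (m := 1) (by norm_num)).differentiableAt
        one_ne_zero) (hPd T)
  rw [hact2, hact2, ← fderiv_lieBracket_apply (hf' _ (e.map_source hx)) (hPd X) (hPd Y),
    mvfderiv_comp_extChartAt hx (hff x hx) ((hf' _ (e.map_source hx)).differentiableAt (by simp))]
  congr 1
  have h1 := VectorField.mlieBracketWithin_apply (I := 𝓘(ℝ, V)) (s := Set.univ) (x₀ := x)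
    (V := X) (W := Y)
  rw [VectorField.mlieBracketWithin_univ] at h1
  rw [h1]
  refine ((isInvertible_mfderiv_extChartAt hx).self_apply_inverse _).trans ?_
  have hset : (extChartAt 𝓘(ℝ, V) x).symm ⁻¹' Set.univ ∩ Set.range 𝓘(ℝ, V) = Set.univ := by simp
  rw [hset]
  exact congrFun (VectorField.lieBracketWithin_univ (𝕜 := ℝ) (V := P X) (W := P Y)) (e x)

/-- The Lie bracket of smooth vector fields. -/
def lie (X Y : SmoothVectorField V M) : SmoothVectorField V M :=
  ⟨VectorField.mlieBracket 𝓘(ℝ, V) X Y, fun x => by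
    have : IsManifold 𝓘(ℝ, V) (minSmoothness ℝ 2) M := IsManifold.of_le (n := ∞) (by
      rw [minSmoothness_of_isRCLikeNormedField]
      exact WithTop.coe_le_coe.2 (le_top : (2 : ℕ∞) ≤ ⊤))
    have : IsManifold 𝓘(ℝ, V) (((⊤ : ℕ∞) : ℕ∞ω) + 1) M := by simpa
    exact ContMDiffAt.mlieBracket_vectorField (n := ⊤) (m := ⊤) (X.contMDiff x) (Y.contMDiff x)
      (by simp)⟩

/-- From here on no chart is needed for brackets: their identities become ring identities between
derivations. -/
theorem act_lie (X Y : SmoothVectorField V M) (f : SmoothFunction V M) :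
    act (lie X Y) f = act X (act Y f) - act Y (act X f) := by
  ext x
  exact mvfderiv_mlieBracket X Y f x

end LieBracketAct

/-! ### Extending germs by bump functions; local coordinates -/

section Extension

variable {V : Type*} [NormedAddCommGroup V] [NormedSpace ℝ V] [FiniteDimensional ℝ V]
  {M : Type*} [TopologicalSpace M] [ChartedSpace V M] [IsManifold 𝓘(ℝ, V) ∞ M] [T2Space M]

theorem exists_smoothFunction_eventuallyEq_one {x : M} {O : Set M} (hO : O ∈ 𝓝 x) :
    ∃ ψ : SmoothFunction V M, tsupport ψ ⊆ O ∧ ∀ᶠ y in 𝓝 x, ψ y = 1 := by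
  obtain ⟨f, -, hf⟩ := (SmoothBumpFunction.nhds_basis_tsupport (I := 𝓘(ℝ, V)) x).mem_iff.1 hO
  exact ⟨⟨f, f.contMDiff⟩, hf, f.eventuallyEq_one⟩

/-- Algebroid brackets act on global sections only, so local data are cut off by a bump function
that is one near the point. -/
theorem exists_section_eventuallyEq {F : Type*} [NormedAddCommGroup F] [NormedSpace ℝ F]
    {B : M → Type*} [TopologicalSpace (TotalSpace F B)] [∀ x, AddCommGroup (B x)]
    [∀ x, Module ℝ (B x)] [∀ x, TopologicalSpace (B x)] [FiberBundle F B] [VectorBundle ℝ F B]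
    {O : Set M} (hO : IsOpen O) {x : M} (hx : x ∈ O) {s : Π y, B y}
    (hs : ContMDiffOn 𝓘(ℝ, V) (𝓘(ℝ, V).prod 𝓘(ℝ, F)) ∞ (fun y => TotalSpace.mk' F y (s y)) O) :
    ∃ t : Cₛ^∞⟮𝓘(ℝ, V); F, B⟯, ∀ᶠ y in 𝓝 x, t y = s y := by
  obtain ⟨ψ, hψ, hψ1⟩ := exists_smoothFunction_eventuallyEq_one (V := V) (hO.mem_nhds hx)
  refine ⟨⟨fun y => ψ y • s y, ψ.contMDiff.contMDiffOn.smul_section_of_tsupport hO hψ hs⟩, ?_⟩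
  filter_upwards [hψ1] with y hy
  change ψ y • s y = s y
  rw [hy, one_smul]

theorem exists_smoothFunction_eventuallyEq {O : Set M} (hO : IsOpen O) {x : M} (hx : x ∈ O)
    {f : M → ℝ} (hf : ContMDiffOn 𝓘(ℝ, V) 𝓘(ℝ, ℝ) ∞ f O) :
    ∃ g : SmoothFunction V M, (g : M → ℝ) =ᶠ[𝓝 x] f := by
  obtain ⟨ψ, hψ, hψ1⟩ := exists_smoothFunction_eventuallyEq_one (V := V) (hO.mem_nhds hx)
  refine ⟨⟨fun y => ψ y * f y, contMDiff_of_tsupport fun y hy => ?_⟩, ?_⟩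
  · exact ψ.contMDiff.contMDiffAt.mul
      (hf.contMDiffAt (hO.mem_nhds (hψ (tsupport_mul_subset_left hy))))
  · filter_upwards [hψ1] with y hy
    change ψ y * f y = f y
    rw [hy, one_mul]

/-- At `y`, the differentials of the functions `φᵢ` are dual to the vector fields `Dⱼ`, which form
a basis. -/
structure IsDualFrameAt {ι : Type*} [Fintype ι] [DecidableEq ι] (φ : ι → SmoothFunction V M)
    (D : ι → SmoothVectorField V M) (y : M) : Prop where
  dual : ∀ i j, mvfderiv 𝓘(ℝ, V) (φ i) y (D j y) = if i = j then 1 else 0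
  vector_eq : ∀ v : TangentSpace 𝓘(ℝ, V) y, v = ∑ i, mvfderiv 𝓘(ℝ, V) (φ i) y v • D i y

theorem IsDualFrameAt.covector_eq {ι : Type*} [Fintype ι] [DecidableEq ι]
    {φ : ι → SmoothFunction V M} {D : ι → SmoothVectorField V M} {y : M}
    (h : IsDualFrameAt φ D y) (α : Cotangent V y) :
    α = ∑ i, α (D i y) • mvfderiv 𝓘(ℝ, V) (φ i) y := by
  ext v
  conv_lhs => rw [h.vector_eq v]
  rw [map_sum, _root_.sum_apply]
  refine Finset.sum_congr rfl fun i _ => ?_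
  rw [map_smul]
  simp [mul_comm]

theorem IsDualFrameAt.linearIndependent {ι : Type*} [Fintype ι] [DecidableEq ι]
    {φ : ι → SmoothFunction V M} {D : ι → SmoothVectorField V M} {y : M}
    (h : IsDualFrameAt φ D y) : LinearIndependent ℝ (fun i => D i y) := by
  rw [Fintype.linearIndependent_iff]
  intro g hg i
  have := congrArg (mvfderiv 𝓘(ℝ, V) (φ i) y) hg
  rw [map_sum, map_zero] at this
  simpa [map_smul, h.dual] using! this

/-- The functions are the coordinates of the chart and the fields are the pullbacks of the constant
fields `b i`, both extended from germs at `x`. The chart is left arbitrary so that charts adapted to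
a submersion can be used. -/
theorem exists_coordinates_of_chart {c : OpenPartialHomeomorph M V}
    (hc : c ∈ IsManifold.maximalAtlas 𝓘(ℝ, V) ∞ M) {x : M} (hx : x ∈ c.source)
    {ι : Type*} [Fintype ι] [DecidableEq ι] (b : Module.Basis ι ℝ V) :
    ∃ (φ : ι → SmoothFunction V M) (D : ι → SmoothVectorField V M),
      (∀ᶠ y in 𝓝 x, IsDualFrameAt φ D y) ∧ ∀ i, ∀ᶠ y in 𝓝 x, φ i y = b.repr (c y) i := by
  have hcs := contMDiffOn_of_mem_maximalAtlas hc
  have hcs' := contMDiffOn_symm_of_mem_maximalAtlas hc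
  have hcm : c.MDifferentiable 𝓘(ℝ, V) 𝓘(ℝ, V) :=
    ⟨hcs.mdifferentiableOn (by simp), hcs'.mdifferentiableOn (by simp)⟩
  have hinv : ∀ y ∈ c.source, (mfderiv 𝓘(ℝ, V) 𝓘(ℝ, V) c y).IsInvertible := fun y hy =>
    ⟨hcm.mfderiv hy, rfl⟩
  have hφ : ∀ i, ∃ g : SmoothFunction V M, (g : M → ℝ) =ᶠ[𝓝 x] fun y => b.repr (c y) i := by
    intro i
    refine exists_smoothFunction_eventuallyEq c.open_source hx ?_
    have : ContMDiff 𝓘(ℝ, V) 𝓘(ℝ, ℝ) ∞ (b.coord i).toContinuousLinearMap :=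
      (b.coord i).toContinuousLinearMap.contMDiff
    exact this.comp_contMDiffOn hcs
  have hD : ∀ i, ∃ D : SmoothVectorField V M, ∀ᶠ y in 𝓝 x,
      D y = VectorField.mpullback 𝓘(ℝ, V) 𝓘(ℝ, V) c (fun _ => b i) y := by
    intro i
    refine exists_section_eventuallyEq c.open_source hx fun y hy => ContMDiffAt.contMDiffWithinAt ?_
    refine ContMDiffAt.mpullback_vectorField_preimage (n := ∞) (m := ∞) ?_
      (hcs.contMDiffAt (c.open_source.mem_nhds hy)) (hinv y hy) (by simp)
    exact contMDiffAt_vectorSpace_iff_contDiffAt.2 contDiffAt_const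
  choose φ hφ using hφ
  choose D hD using hD
  refine ⟨φ, D, ?_, hφ⟩
  -- Duality involves derivatives at each nearby `y`, so the functions must agree as germs at `y`
  -- and not only in value.
  have hφ' : ∀ᶠ y in 𝓝 x, ∀ i, (φ i : M → ℝ) =ᶠ[𝓝 y] fun y => b.repr (c y) i :=
    eventually_all.2 fun i => (hφ i).eventuallyEq_nhds
  have hD' := eventually_all.2 hD
  filter_upwards [hφ', hD', c.open_source.mem_nhds hx] with y h1 h2 hy
  have hd : ∀ i v, mvfderiv 𝓘(ℝ, V) (φ i) y v =
      b.repr (mfderiv 𝓘(ℝ, V) 𝓘(ℝ, V) c y v) i := by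
    intro i v
    have h3 : mfderiv 𝓘(ℝ, V) 𝓘(ℝ, ℝ) (φ i) y
        = mfderiv 𝓘(ℝ, V) 𝓘(ℝ, ℝ) ((b.coord i).toContinuousLinearMap ∘ c) y := (h1 i).mfderiv_eq
    rw [mfderiv_comp (I' := 𝓘(ℝ, V)) y
      (b.coord i).toContinuousLinearMap.differentiableAt.mdifferentiableAt
      (hcm.mdifferentiableAt hy), mfderiv_eq_fderiv, ContinuousLinearMap.fderiv] at h3
    exact DFunLike.congr_fun h3 v
  have hDc : ∀ i, mfderiv 𝓘(ℝ, V) 𝓘(ℝ, V) c y (D i y) = b i := by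
    intro i
    rw [h2 i]
    exact (hinv y hy).self_apply_inverse _
  refine ⟨fun i j => ?_, fun v => ?_⟩
  · rw [hd, hDc]
    exact (b.repr_self_apply j i).trans (by simp [eq_comm])
  · apply (hcm.mfderiv hy).injective
    change mfderiv 𝓘(ℝ, V) 𝓘(ℝ, V) c y v = mfderiv 𝓘(ℝ, V) 𝓘(ℝ, V) c y _
    rw [map_sum]
    simp only [map_smul, hd, hDc]
    exact (b.sum_repr _).symm

theorem exists_coordinates (x : M) :
    ∃ (n : ℕ) (φ : Fin n → SmoothFunction V M) (D : Fin n → SmoothVectorField V M),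
      ∀ᶠ y in 𝓝 x, IsDualFrameAt φ D y := by
  obtain ⟨φ, D, h, -⟩ := exists_coordinates_of_chart (IsManifold.chart_mem_maximalAtlas x)
    (mem_chart_source V x) (Module.finBasis ℝ V)
  exact ⟨_, φ, D, h⟩

end Extension

/-! ### Frames adapted to a submersion -/

section SubmersionFrame

variable {V : Type*} [NormedAddCommGroup V] [NormedSpace ℝ V] [FiniteDimensional ℝ V]
  {E : Type*} [TopologicalSpace E] [ChartedSpace V E] [IsManifold 𝓘(ℝ, V) ∞ E] [T2Space E]
  {W : Type*} [NormedAddCommGroup W] [NormedSpace ℝ W] [FiniteDimensional ℝ W]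
  {X : Type*} [TopologicalSpace X] [ChartedSpace W X] [IsManifold 𝓘(ℝ, W) ∞ X] [T2Space X]

/-- The pullback of a smooth function along a smooth map. -/
def pullbackFunction (p : C^∞⟮𝓘(ℝ, V), E; 𝓘(ℝ, W), X⟯) (f : SmoothFunction W X) :
    SmoothFunction V E :=
  f.comp p

theorem pullbackFunction_apply (p : C^∞⟮𝓘(ℝ, V), E; 𝓘(ℝ, W), X⟯) (f : SmoothFunction W X) (y : E) :
    pullbackFunction p f y = f (p y) := rfl

theorem mvfderiv_pullbackFunction (p : C^∞⟮𝓘(ℝ, V), E; 𝓘(ℝ, W), X⟯) (f : SmoothFunction W X)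
    (y : E) (v : TangentSpace 𝓘(ℝ, V) y) :
    mvfderiv 𝓘(ℝ, V) (pullbackFunction p f) y v =
      mvfderiv 𝓘(ℝ, W) f (p y) (mfderiv 𝓘(ℝ, V) 𝓘(ℝ, W) p y v) :=
  mvfderiv_comp_apply y (f.mdifferentiableAt _) (p.contMDiff.mdifferentiable (by simp) y) v

/-- Near every point, a submersion `p` has a frame `Z, K` of `TE` such that `Z` projects to the
coordinate frame `D` of coordinates `χ` on the base and `K` is a frame of the vertical bundle. -/
structure IsSubmersionFrameAt (p : C^∞⟮𝓘(ℝ, V), E; 𝓘(ℝ, W), X⟯) {m k : ℕ}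
    (χ : Fin m → SmoothFunction W X) (D : Fin m → SmoothVectorField W X)
    (Z : Fin m → SmoothVectorField V E) (K : Fin k → SmoothVectorField V E) (y : E) : Prop where
  base : IsDualFrameAt χ D (p y)
  lift : ∀ l, mfderiv 𝓘(ℝ, V) 𝓘(ℝ, W) p y (Z l y) = D l (p y)
  linearIndependent : LinearIndependent ℝ (fun j => K j y)
  span : Submodule.span ℝ (Set.range fun j => K j y) = verticalFiber p y

/-- In the charts that define a submersion, `p` is the projection `W × F → W`. The coordinate fields
along `W` are the lifts `Z`, and those along `F` are the vertical frame `K`. -/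
theorem exists_submersion_frame {p : C^∞⟮𝓘(ℝ, V), E; 𝓘(ℝ, W), X⟯}
    (hp : Manifold.IsSubmersion 𝓘(ℝ, V) 𝓘(ℝ, W) ∞ p) (e : E) :
    ∃ (m k : ℕ) (χ : Fin m → SmoothFunction W X) (D : Fin m → SmoothVectorField W X)
      (Z : Fin m → SmoothVectorField V E) (K : Fin k → SmoothVectorField V E),
      ∀ᶠ y in 𝓝 e, IsSubmersionFrameAt p χ D Z K y := by
  have h := hp.isSubmersionAt e
  have : FiniteDimensional ℝ h.complement :=
    Module.Finite.of_surjective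
      ((LinearMap.snd ℝ W h.complement).comp (h.equiv : V →ₗ[ℝ] W × h.complement))
      (Prod.snd_surjective.comp h.equiv.surjective)
  let bW := Module.finBasis ℝ W
  let bF := Module.finBasis ℝ h.complement
  -- This basis of `V` is compatible with the splitting, so the coordinates with index `Sum.inl l`
  -- are the functions `χ l ∘ p` near `e`.
  let b := (bW.prod bF).map h.equiv.symm.toLinearEquiv
  obtain ⟨φ, D', hD', hφ⟩ := exists_coordinates_of_chart h.domChart_mem_maximalAtlas
    h.mem_domChart_source b
  obtain ⟨χ, D, hD, hχ⟩ := exists_coordinates_of_chart h.codChart_mem_maximalAtlas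
    h.mem_codChart_source bW
  have hpc : ContinuousAt p e := p.contMDiff.continuous.continuousAt
  have hcomp : ∀ l, ∀ᶠ y in 𝓝 e, φ (Sum.inl l) y = pullbackFunction p (χ l) y := by
    intro l
    filter_upwards [hφ (Sum.inl l), hpc.eventually (hχ l),
      h.domChart.open_source.mem_nhds h.mem_domChart_source] with y h1 h2 hy
    have h3 := h.writtenInCharts
      (show h.domChart y ∈ (h.domChart.extend 𝓘(ℝ, V)).target by
        simpa using h.domChart.map_source hy)
    simp only [Function.comp_apply, OpenPartialHomeomorph.extend_coe,
      OpenPartialHomeomorph.extend_coe_symm, modelWithCornersSelf_coe,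
      modelWithCornersSelf_coe_symm, id_eq, h.domChart.left_inv hy] at h3
    rw [h1, pullbackFunction_apply, h2, h3]
    simp [b]
  refine ⟨_, _, χ, D, fun l => D' (Sum.inl l), fun j => D' (Sum.inr j), ?_⟩
  have hcomp' : ∀ᶠ y in 𝓝 e, ∀ l, (φ (Sum.inl l) : E → ℝ) =ᶠ[𝓝 y] pullbackFunction p (χ l) :=
    eventually_all.2 fun l => EventuallyEq.eventuallyEq_nhds (hcomp l)
  filter_upwards [hD', hpc.eventually hD, hcomp'] with y h1 h2 h3
  -- The coordinates of `p_*v` are the first block of the coordinates of `v`; the lifting property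
  -- and verticality both follow from this and duality.
  have hd : ∀ l v, mvfderiv 𝓘(ℝ, W) (χ l) (p y) (mfderiv 𝓘(ℝ, V) 𝓘(ℝ, W) p y v)
      = mvfderiv 𝓘(ℝ, V) (φ (Sum.inl l)) y v := by
    intro l v
    rw [← mvfderiv_pullbackFunction]
    exact (DFunLike.congr_fun (h3 l).mfderiv_eq v).symm
  have hK : ∀ j, mfderiv 𝓘(ℝ, V) 𝓘(ℝ, W) p y (D' (Sum.inr j) y) = 0 := by
    intro j
    rw [h2.vector_eq (mfderiv 𝓘(ℝ, V) 𝓘(ℝ, W) p y (D' (Sum.inr j) y))]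
    simp [hd, h1.dual]
  refine ⟨h2, fun l => ?_, h1.linearIndependent.comp _ Sum.inr_injective, ?_⟩
  · rw [h2.vector_eq (mfderiv 𝓘(ℝ, V) 𝓘(ℝ, W) p y (D' (Sum.inl l) y))]
    simp [hd, h1.dual]
  · apply le_antisymm
    · rw [Submodule.span_le]
      rintro _ ⟨j, rfl⟩
      exact hK j
    · intro v hv
      rw [h1.vector_eq v, Fintype.sum_sum_type]
      have hv0 : mfderiv 𝓘(ℝ, V) 𝓘(ℝ, W) p y v = 0 := hv
      simp only [← hd, hv0, map_zero, zero_smul, Finset.sum_const_zero, zero_add]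
      exact Submodule.sum_mem _ fun j _ =>
        Submodule.smul_mem _ _ (Submodule.subset_span ⟨j, rfl⟩)

theorem IsSubmersionFrameAt.surjective {p : C^∞⟮𝓘(ℝ, V), E; 𝓘(ℝ, W), X⟯} {m k : ℕ}
    {χ : Fin m → SmoothFunction W X} {D : Fin m → SmoothVectorField W X}
    {Z : Fin m → SmoothVectorField V E} {K : Fin k → SmoothVectorField V E} {y : E}
    (h : IsSubmersionFrameAt p χ D Z K y) :
    Function.Surjective (mfderiv 𝓘(ℝ, V) 𝓘(ℝ, W) p y) := by
  intro w
  refine ⟨∑ l, mvfderiv 𝓘(ℝ, W) (χ l) (p y) w • Z l y, ?_⟩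
  rw [map_sum]
  simp only [map_smul, h.lift]
  exact (h.base.vector_eq w).symm

theorem mfderiv_surjective_of_isSubmersion {p : C^∞⟮𝓘(ℝ, V), E; 𝓘(ℝ, W), X⟯}
    (hp : Manifold.IsSubmersion 𝓘(ℝ, V) 𝓘(ℝ, W) ∞ p) (e : E) :
    Function.Surjective (mfderiv 𝓘(ℝ, V) 𝓘(ℝ, W) p e) := by
  obtain ⟨_, _, _, _, _, _, h⟩ := exists_submersion_frame hp e
  exact h.self_of_nhds.surjective

end SubmersionFrame

/-! ### Separation by functions and fields; tensoriality -/

section VectorFieldsAndForms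

variable {V : Type*} [NormedAddCommGroup V] [NormedSpace ℝ V] [FiniteDimensional ℝ V]
  {M : Type*} [TopologicalSpace M] [ChartedSpace V M] [IsManifold 𝓘(ℝ, V) ∞ M] [T2Space M]

theorem tangent_ext {x : M} {v w : TangentSpace 𝓘(ℝ, V) x}
    (h : ∀ f : SmoothFunction V M, mvfderiv 𝓘(ℝ, V) f x v = mvfderiv 𝓘(ℝ, V) f x w) : v = w := by
  obtain ⟨n, φ, D, hD⟩ := exists_coordinates (V := V) x
  rw [hD.self_of_nhds.vector_eq v, hD.self_of_nhds.vector_eq w]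
  simp only [h]

/-- Coordinate functions, extended globally, detect every tangent vector. Together with `act_lie`
this reduces identities between vector fields to commutator algebra. -/
theorem vectorField_ext {X Y : SmoothVectorField V M}
    (h : ∀ f : SmoothFunction V M, act X f = act Y f) : X = Y := by
  ext x
  exact tangent_ext fun f => DFunLike.congr_fun (h f) x

theorem exists_vectorField_eq (x : M) (v : TangentSpace 𝓘(ℝ, V) x) :
    ∃ Y : SmoothVectorField V M, Y x = v := by
  obtain ⟨n, φ, D, hD⟩ := exists_coordinates (V := V) x
  refine ⟨∑ i, mvfderiv 𝓘(ℝ, V) (φ i) x v • D i, ?_⟩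
  rw [section_sum_apply]
  exact (hD.self_of_nhds.vector_eq v).symm

theorem cotangent_ext {x : M} {α β : Cotangent V x}
    (h : ∀ Y : SmoothVectorField V M, α (Y x) = β (Y x)) : α = β := by
  ext v
  obtain ⟨Y, rfl⟩ := exists_vectorField_eq x v
  exact h Y

theorem oneForm_ext {α β : OneForm V M}
    (h : ∀ Y : SmoothVectorField V M, pair α Y = pair β Y) : α = β := by
  ext1 x
  exact cotangent_ext fun Y => DFunLike.congr_fun (h Y) x

theorem lie_swap (X Y : SmoothVectorField V M) : lie X Y = -lie Y X :=
  vectorField_ext fun f => by simp only [act_lie, act_neg_left]; ring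
theorem lie_self (X : SmoothVectorField V M) : lie X X = 0 := by
  ext x; exact congrFun (VectorField.mlieBracket_self (I := 𝓘(ℝ, V)) (V := X)) x
theorem lie_add_left (X Y Z : SmoothVectorField V M) : lie (X + Y) Z = lie X Z + lie Y Z :=
  vectorField_ext fun f => by simp only [act_lie, act_add_left, act_add]; ring
theorem lie_add_right (X Y Z : SmoothVectorField V M) : lie X (Y + Z) = lie X Y + lie X Z :=
  vectorField_ext fun f => by simp only [act_lie, act_add_left, act_add]; ring
theorem lie_smul_left (c : ℝ) (X Y : SmoothVectorField V M) : lie (c • X) Y = c • lie X Y :=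
  vectorField_ext fun f => by simp only [act_lie, act_smul_left, act_smul, smul_sub]
theorem lie_smul_right (c : ℝ) (X Y : SmoothVectorField V M) : lie X (c • Y) = c • lie X Y :=
  vectorField_ext fun f => by simp only [act_lie, act_smul_left, act_smul, smul_sub]
theorem lie_fsmul_right (g : SmoothFunction V M) (X Y : SmoothVectorField V M) :
    lie X (fsmul g Y) = fsmul g (lie X Y) + fsmul (act X g) Y :=
  vectorField_ext fun f => by
    simp only [act_lie, act_add_left, act_fsmul_left, act_mul]; ring
theorem lie_fsmul_left (g : SmoothFunction V M) (X Y : SmoothVectorField V M) :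
    lie (fsmul g X) Y = fsmul g (lie X Y) - fsmul (act Y g) X :=
  vectorField_ext fun f => by
    simp only [act_lie, act_sub_left, act_fsmul_left, act_mul]; ring
theorem lie_jacobi (X Y Z : SmoothVectorField V M) :
    lie X (lie Y Z) + lie Y (lie Z X) + lie Z (lie X Y) = 0 :=
  vectorField_ext fun f => by
    simp only [act_lie, act_add_left, act_sub]
    have : act (0 : SmoothVectorField V M) f = 0 := by
      ext x; exact map_zero (differential f x)
    rw [this]; ring

theorem lie_lie (X Y Z : SmoothVectorField V M) :
    lie (lie X Y) Z = lie X (lie Y Z) - lie Y (lie X Z) :=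
  vectorField_ext fun f => by simp only [act_lie, act_sub_left, act_sub]; ring

theorem exists_oneForm_eventuallyEq_sum (α : OneForm V M) (x : M) :
    ∃ (n : ℕ) (h φ : Fin n → SmoothFunction V M),
      ∀ᶠ y in 𝓝 x, α y = ∑ i, h i y • mvfderiv 𝓘(ℝ, V) (φ i) y := by
  obtain ⟨n, φ, D, hD⟩ := exists_coordinates (V := V) x
  exact ⟨n, fun i => pair α (D i), φ, hD.mono fun y hy => hy.covector_eq (α y)⟩

section Cutoff

variable {F : Type*} [NormedAddCommGroup F] [NormedSpace ℝ F]
    {B : M → Type*} [TopologicalSpace (TotalSpace F B)] [∀ x, AddCommGroup (B x)]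
    [∀ x, Module ℝ (B x)] [∀ x, TopologicalSpace (B x)] [FiberBundle F B] [VectorBundle ℝ F B]

theorem exists_fsmul_eq {s t : Cₛ^∞⟮𝓘(ℝ, V); F, B⟯} {x : M} (h : ∀ᶠ y in 𝓝 x, s y = t y) :
    ∃ ψ : SmoothFunction V M, ψ x = 1 ∧ fsmul ψ s = fsmul ψ t := by
  obtain ⟨ψ, hψ, hψ1⟩ := exists_smoothFunction_eventuallyEq_one (V := V) h
  refine ⟨ψ, hψ1.self_of_nhds, ?_⟩
  ext1 y
  rw [fsmul_apply, fsmul_apply]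
  by_cases hy : y ∈ tsupport ψ
  · rw [hψ hy]
  · rw [image_eq_zero_of_notMem_tsupport hy, zero_smul, zero_smul]

/-- A function-linear operation on sections depends only on germs. -/
theorem functionLinear_local {T : Cₛ^∞⟮𝓘(ℝ, V); F, B⟯ → SmoothFunction V M}
    (hT : ∀ f s, T (fsmul f s) = f * T s) {s t : Cₛ^∞⟮𝓘(ℝ, V); F, B⟯} {x : M}
    (h : ∀ᶠ y in 𝓝 x, s y = t y) : T s x = T t x := by
  obtain ⟨ψ, hψ, he⟩ := exists_fsmul_eq h
  have := congrArg T he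
  rw [hT, hT] at this
  have h2 := DFunLike.congr_fun this x
  change ψ x * T s x = ψ x * T t x at h2
  simpa [hψ] using h2

theorem functionLinear_sum {T : Cₛ^∞⟮𝓘(ℝ, V); F, B⟯ → SmoothFunction V M}
    (hadd : ∀ s t, T (s + t) = T s + T t) (hT : ∀ f s, T (fsmul f s) = f * T s)
    {ι : Type*} (S : Finset ι) (h : ι → SmoothFunction V M) (s : ι → Cₛ^∞⟮𝓘(ℝ, V); F, B⟯) :
    T (∑ i ∈ S, fsmul (h i) (s i)) = ∑ i ∈ S, h i * T (s i) := by
  let T' : Cₛ^∞⟮𝓘(ℝ, V); F, B⟯ →+ SmoothFunction V M := AddMonoidHom.mk' T hadd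
  have := map_sum T' (fun i => fsmul (h i) (s i)) S
  exact this.trans (Finset.sum_congr rfl fun i _ => hT _ _)

end Cutoff

theorem smoothFunction_sum_apply {ι : Type*} (S : Finset ι) (f : ι → SmoothFunction V M) (x : M) :
    (∑ i ∈ S, f i) x = ∑ i ∈ S, f i x := by
  have := map_sum (ContMDiffMap.evalRingHom (I := 𝓘(ℝ, V)) (R := ℝ) (n := ∞) x) f S
  exact this

/-- A function-linear operation on one-forms that vanishes on exact forms is zero. -/
theorem functionLinear_eq_zero {T : OneForm V M → SmoothFunction V M}
    (hadd : ∀ α β, T (α + β) = T α + T β) (hT : ∀ f α, T (fsmul f α) = f * T α)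
    (hd : ∀ f, T (differential f) = 0) (α : OneForm V M) : T α = 0 := by
  ext x
  obtain ⟨n, h, φ, hα⟩ := exists_oneForm_eventuallyEq_sum α x
  have hα' : ∀ᶠ y in 𝓝 x, α y = (∑ i, fsmul (h i) (differential (φ i))) y := by
    filter_upwards [hα] with y hy
    rw [hy, section_sum_apply]
    rfl
  rw [functionLinear_local hT hα', functionLinear_sum hadd hT]
  simp [hd]

/-- A function-linear operation on vector fields is the pairing with a one-form. -/
theorem exists_oneForm_of_functionLinear {T : SmoothVectorField V M → SmoothFunction V M}
    (hadd : ∀ X Y, T (X + Y) = T X + T Y) (hT : ∀ f X, T (fsmul f X) = f * T X) :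
    ∃ τ : OneForm V M, ∀ Y, pair τ Y = T Y := by
  -- Locality and function-linearity express `T Y` at `y` through the values of `T` on any frame
  -- near `y`. Hence the form below does not depend on the frame.
  have key : ∀ {n : ℕ} (φ : Fin n → SmoothFunction V M) (D : Fin n → SmoothVectorField V M) (y : M),
      (∀ᶠ z in 𝓝 y, IsDualFrameAt φ D z) → ∀ Y : SmoothVectorField V M,
      T Y y = ∑ i, mvfderiv 𝓘(ℝ, V) (φ i) y (Y y) * T (D i) y := by
    intro n φ D y hD Y
    have hY : ∀ᶠ z in 𝓝 y, Y z = (∑ i, fsmul (act Y (φ i)) (D i)) z := by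
      filter_upwards [hD] with z hz
      rw [section_sum_apply]
      exact hz.vector_eq (Y z)
    rw [functionLinear_local hT hY, functionLinear_sum hadd hT, smoothFunction_sum_apply]
    rfl
  choose n φ D hD using fun x : M => exists_coordinates (V := V) x
  let τ : Π x : M, Cotangent V x := fun x =>
    ∑ i, T (D x i) x • mvfderiv 𝓘(ℝ, V) (φ x i) x
  have hτ : ∀ x (Y : SmoothVectorField V M), τ x (Y x) = T Y x := by
    intro x Y
    rw [key (φ x) (D x) x (hD x) Y]
    simp only [τ, _root_.sum_apply, _root_.smul_apply, smul_eq_mul, mul_comm]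
  refine ⟨⟨τ, fun x => ?_⟩, fun Y => ?_⟩
  · refine ((∑ i, fsmul (T (D x i)) (differential (φ x i))).contMDiff x).congr_of_eventuallyEq ?_
    -- The value `τ y` is defined with the frame chosen at `y`, but by `key` the frame chosen at `x`
    -- gives the same covector, with smooth coefficients.
    filter_upwards [(hD x).eventually_nhds] with y hy
    congr 1
    refine cotangent_ext fun Y => ?_
    rw [hτ, key (φ x) (D x) y hy Y, section_sum_apply, _root_.sum_apply]
    exact Finset.sum_congr rfl fun i _ => mul_comm _ _
  · ext x
    exact hτ x Y

end VectorFieldsAndForms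

/-! ### Coordinate coframes -/

section DualFrames

variable {V : Type*} [NormedAddCommGroup V] [NormedSpace ℝ V] [FiniteDimensional ℝ V]
  {M : Type*} [TopologicalSpace M] [ChartedSpace V M] [IsManifold 𝓘(ℝ, V) ∞ M] [T2Space M]
  {n : ℕ} {φ : Fin n → SmoothFunction V M} {D : Fin n → SmoothVectorField V M} {x : M}

theorem IsDualFrameAt.linearIndependent_differential (h : IsDualFrameAt φ D x) :
    LinearIndependent ℝ fun i => differential (φ i) x := by
  rw [Fintype.linearIndependent_iff]
  intro g hg j
  have := DFunLike.congr_fun hg (D j x)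
  rw [_root_.sum_apply] at this
  simpa [differential_apply, h.dual] using! this

theorem IsDualFrameAt.span_differential (h : IsDualFrameAt φ D x) :
    Submodule.span ℝ (Set.range fun i => differential (φ i) x) = ⊤ := by
  rw [eq_top_iff]
  intro α _
  rw [h.covector_eq α]
  exact Submodule.sum_mem _ fun i _ => Submodule.smul_mem _ _ (Submodule.subset_span ⟨i, rfl⟩)

end DualFrames

/-! ### The cotangent Lie algebroid of a Poisson structure -/

section CotangentAlgebroid

variable {V : Type*} [NormedAddCommGroup V] [NormedSpace ℝ V]
  {M : Type*} [TopologicalSpace M] [ChartedSpace V M] [IsManifold 𝓘(ℝ, V) ∞ M]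

namespace PoissonStructure

/-- The vector field `π♯ α`. -/
def field (ϖ : PoissonStructure V M) (α : OneForm V M) : SmoothVectorField V M :=
  ⟨fun x => ϖ.sharp x (α x), ContMDiff.clm_bundle_apply (b := fun y => y)
    (E₁ := fun x : M => Cotangent V x) ϖ.sharp.contMDiff α.contMDiff⟩

variable (ϖ : PoissonStructure V M)

theorem field_add (α β : OneForm V M) : ϖ.field (α + β) = ϖ.field α + ϖ.field β := by
  ext x; exact map_add (ϖ.sharp x) _ _
theorem field_smul (c : ℝ) (α : OneForm V M) : ϖ.field (c • α) = c • ϖ.field α := by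
  ext x; exact map_smul (ϖ.sharp x) _ _
theorem field_fsmul (f : SmoothFunction V M) (α : OneForm V M) :
    ϖ.field (fsmul f α) = fsmul f (ϖ.field α) := by
  ext x; exact map_smul (ϖ.sharp x) _ _

theorem pair_field_swap (α β : OneForm V M) : pair β (ϖ.field α) = -pair α (ϖ.field β) := by
  ext x; exact ϖ.skew x (α x) (β x)

theorem pair_field_self (α : OneForm V M) : pair α (ϖ.field α) = 0 := by
  ext x
  have := ϖ.skew x (α x) (α x)
  change α x (ϖ.sharp x (α x)) = 0
  linarith

theorem jacobi_differential (f g h : SmoothFunction V M) :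
    act (ϖ.field (differential f)) (act (ϖ.field (differential g)) h)
      + act (ϖ.field (differential g)) (act (ϖ.field (differential h)) f)
      + act (ϖ.field (differential h)) (act (ϖ.field (differential f)) g) = 0 := by
  ext x
  exact ϖ.jacobi f g h f.contMDiff g.contMDiff h.contMDiff x

end PoissonStructure

variable [FiniteDimensional ℝ V] [T2Space M]

namespace PoissonStructure

variable (ϖ : PoissonStructure V M)

theorem act_field_differential_swap (f g : SmoothFunction V M) :
    act (ϖ.field (differential f)) g = -act (ϖ.field (differential g)) f :=
  ϖ.pair_field_swap (differential f) (differential g)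

/-- The value of `L_{π♯ξ} η - L_{π♯η} ξ - d(π(ξ, η))` on a vector field. -/
def bracketPairing (ξ η : OneForm V M) (Y : SmoothVectorField V M) : SmoothFunction V M :=
  act (ϖ.field ξ) (pair η Y) - pair η (lie (ϖ.field ξ) Y)
    - (act (ϖ.field η) (pair ξ Y) - pair ξ (lie (ϖ.field η) Y)) - act Y (pair η (ϖ.field ξ))

/-- The expression is function-linear in `Y`: the derivatives of the factor coming from `act` and
from `lie` cancel. -/
theorem exists_bracket (ξ η : OneForm V M) :
    ∃ τ : OneForm V M, ∀ Y, pair τ Y = ϖ.bracketPairing ξ η Y := by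
  refine exists_oneForm_of_functionLinear (fun X Y => ?_) (fun f Y => ?_)
  · simp only [bracketPairing, pair_add_right, lie_add_right, act_add, act_add_left]
    ring
  · simp only [bracketPairing, pair_fsmul_right, lie_fsmul_right, act_mul, act_fsmul_left,
      pair_add_right]
    ring

/-- The bracket `[ξ, η] = L_{π♯ξ} η - L_{π♯η} ξ - d(π(ξ, η))` of one-forms. -/
def bracket (ξ η : OneForm V M) : OneForm V M := (ϖ.exists_bracket ξ η).choose

theorem pair_bracket (ξ η : OneForm V M) (Y : SmoothVectorField V M) :
    pair (ϖ.bracket ξ η) Y =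
      act (ϖ.field ξ) (pair η Y) - pair η (lie (ϖ.field ξ) Y)
        - (act (ϖ.field η) (pair ξ Y) - pair ξ (lie (ϖ.field η) Y)) - act Y (pair η (ϖ.field ξ)) :=
  (ϖ.exists_bracket ξ η).choose_spec Y

/-- The obstruction to `π♯` being compatible with brackets. -/
def anchorDefect (ξ η ζ : OneForm V M) : SmoothFunction V M :=
  act (ϖ.field ξ) (pair ζ (ϖ.field η)) + act (ϖ.field η) (pair ξ (ϖ.field ζ))
    + act (ϖ.field ζ) (pair η (ϖ.field ξ)) - pair ξ (lie (ϖ.field η) (ϖ.field ζ))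
    - pair η (lie (ϖ.field ζ) (ϖ.field ξ)) - pair ζ (lie (ϖ.field ξ) (ϖ.field η))

/-- Cyclic symmetry transfers additivity and function-linearity from the last argument to all three.
-/
theorem anchorDefect_cyclic (ξ η ζ : OneForm V M) :
    ϖ.anchorDefect ξ η ζ = ϖ.anchorDefect η ζ ξ := by
  simp only [anchorDefect]; ring

theorem anchorDefect_add (ξ η ζ ζ' : OneForm V M) :
    ϖ.anchorDefect ξ η (ζ + ζ') = ϖ.anchorDefect ξ η ζ + ϖ.anchorDefect ξ η ζ' := by
  simp only [anchorDefect, field_add, pair_add_left, pair_add_right, act_add, act_add_left,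
    lie_add_left, lie_add_right]
  ring

/-- The terms in which `f` is differentiated cancel by skew-symmetry of `π`. -/
theorem anchorDefect_fsmul (f : SmoothFunction V M) (ξ η ζ : OneForm V M) :
    ϖ.anchorDefect ξ η (fsmul f ζ) = f * ϖ.anchorDefect ξ η ζ := by
  simp only [anchorDefect, field_fsmul, pair_add_right, pair_sub_right, pair_fsmul_left,
    pair_fsmul_right, act_mul, act_fsmul_left, lie_fsmul_left, lie_fsmul_right]
  rw [ϖ.pair_field_swap ζ η]
  ring

/-- Expanding the commutators and using `{f, g} = -{g, f}` leaves minus the Jacobiator of `f`, `g`,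
`h`. This is where the Jacobi identity of the Poisson bracket enters. -/
theorem anchorDefect_differential (f g h : SmoothFunction V M) :
    ϖ.anchorDefect (differential f) (differential g) (differential h) = 0 := by
  simp only [anchorDefect, pair_differential, act_lie]
  have h1 := ϖ.jacobi_differential f g h
  rw [ϖ.act_field_differential_swap h g, ϖ.act_field_differential_swap f h,
    ϖ.act_field_differential_swap g f]
  simp only [act_neg]
  linear_combination -h1

/-- One-forms are locally function combinations of exact ones, so the arguments are replaced by
differentials one at a time, with a cyclic rotation in between. -/
theorem anchorDefect_eq_zero (ξ η ζ : OneForm V M) : ϖ.anchorDefect ξ η ζ = 0 := by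
  refine functionLinear_eq_zero (T := fun ζ => ϖ.anchorDefect ξ η ζ)
    (ϖ.anchorDefect_add ξ η) (fun f => ϖ.anchorDefect_fsmul f ξ η) (fun h => ?_) ζ
  rw [ϖ.anchorDefect_cyclic, ϖ.anchorDefect_cyclic]
  refine functionLinear_eq_zero (T := fun η => ϖ.anchorDefect (differential h) ξ η)
    (ϖ.anchorDefect_add _ ξ) (fun f => ϖ.anchorDefect_fsmul f _ ξ) (fun g => ?_) η
  rw [ϖ.anchorDefect_cyclic, ϖ.anchorDefect_cyclic]
  exact functionLinear_eq_zero (T := fun ξ => ϖ.anchorDefect (differential g) (differential h) ξ)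
    (ϖ.anchorDefect_add _ _) (fun f => ϖ.anchorDefect_fsmul f _ _)
    (fun f => ϖ.anchorDefect_differential _ _ _) ξ

/-- Tested on a function `f`, the difference of the two sides is the defect at `ξ`, `η`, `df`. -/
theorem field_bracket (ξ η : OneForm V M) :
    ϖ.field (ϖ.bracket ξ η) = lie (ϖ.field ξ) (ϖ.field η) := by
  refine vectorField_ext fun f => ?_
  rw [← pair_differential, ← pair_differential, ϖ.pair_field_swap, pair_bracket]
  have h := ϖ.anchorDefect_eq_zero ξ η (differential f)
  rw [anchorDefect, lie_swap (ϖ.field (differential f)) (ϖ.field ξ), pair_neg_right,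
    ϖ.pair_field_swap η (differential f), act_neg] at h
  rw [← sub_eq_zero]
  linear_combination h

theorem bracket_fsmul (f : SmoothFunction V M) (ξ η : OneForm V M) :
    ϖ.bracket ξ (fsmul f η) = fsmul f (ϖ.bracket ξ η) + fsmul (act (ϖ.field ξ) f) η := by
  refine oneForm_ext fun Y => ?_
  simp only [pair_bracket, pair_add_left, pair_fsmul_left, field_fsmul, lie_fsmul_left,
    pair_sub_right, pair_fsmul_right, act_mul, act_fsmul_left]
  rw [ϖ.pair_field_swap ξ η]
  ring

/-- Paired with `Y` and expanded with `field_bracket`, the Jacobiator reduces to twice the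
derivative along `Y` of the vanishing defect. -/
theorem bracket_jacobi (ξ η ζ : OneForm V M) :
    ϖ.bracket ξ (ϖ.bracket η ζ) + ϖ.bracket η (ϖ.bracket ζ ξ) + ϖ.bracket ζ (ϖ.bracket ξ η) = 0 := by
  refine oneForm_ext fun Y => ?_
  have h0 : pair (0 : OneForm V M) Y = 0 := rfl
  have hY : act Y (ϖ.anchorDefect ξ η ζ) = 0 := by
    rw [anchorDefect_eq_zero]
    simpa using act_smul Y 0 (0 : SmoothFunction V M)
  rw [h0]
  simp only [pair_add_left, pair_bracket, field_bracket, lie_lie, act_lie, pair_sub_right]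
  simp only [anchorDefect] at hY
  rw [ϖ.pair_field_swap ξ ζ, ϖ.pair_field_swap η ξ, ϖ.pair_field_swap ζ η,
    lie_swap (ϖ.field η) (ϖ.field ξ), lie_swap (ϖ.field ζ) (ϖ.field η),
    lie_swap (ϖ.field ξ) (ϖ.field ζ)]
  simp only [act_add, act_sub, act_neg, pair_neg_right] at hY ⊢
  linear_combination 2 * hY

theorem bracket_add_left (ξ ξ' η : OneForm V M) :
    ϖ.bracket (ξ + ξ') η = ϖ.bracket ξ η + ϖ.bracket ξ' η := by
  refine oneForm_ext fun Y => ?_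
  simp only [pair_bracket, pair_add_left, pair_add_right, field_add, lie_add_left, act_add,
    act_add_left]
  ring

theorem bracket_smul_left (c : ℝ) (ξ η : OneForm V M) :
    ϖ.bracket (c • ξ) η = c • ϖ.bracket ξ η := by
  refine oneForm_ext fun Y => ?_
  simp only [pair_bracket, pair_smul_left, pair_smul_right, field_smul, lie_smul_left, act_smul,
    act_smul_left, smul_sub]

theorem bracket_self (ξ : OneForm V M) : ϖ.bracket ξ ξ = 0 := by
  refine oneForm_ext fun Y => ?_
  have h0 : pair (0 : OneForm V M) Y = 0 := rfl
  have hY : act Y (0 : SmoothFunction V M) = 0 := by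
    simpa using act_smul Y 0 (0 : SmoothFunction V M)
  rw [pair_bracket, pair_field_self, hY, h0]
  ring

theorem bracket_swap (ξ η : OneForm V M) : ϖ.bracket ξ η = -ϖ.bracket η ξ := by
  refine oneForm_ext fun Y => ?_
  rw [pair_neg_left, pair_bracket, pair_bracket, ϖ.pair_field_swap η ξ, act_neg]
  ring

theorem bracket_add_right (ξ η η' : OneForm V M) :
    ϖ.bracket ξ (η + η') = ϖ.bracket ξ η + ϖ.bracket ξ η' := by
  rw [bracket_swap, bracket_add_left, bracket_swap ϖ η, bracket_swap ϖ η']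
  abel

theorem bracket_smul_right (c : ℝ) (ξ η : OneForm V M) :
    ϖ.bracket ξ (c • η) = c • ϖ.bracket ξ η := by
  refine oneForm_ext fun Y => ?_
  simp only [pair_bracket, pair_smul_left, pair_smul_right, field_smul, lie_smul_left, act_smul,
    act_smul_left, smul_sub]

end PoissonStructure

/-- A one-form, as a section of the cotangent Lie algebroid. -/
def toSection (α : OneForm V M) : sections V (V →L[ℝ] ℝ) (cotangentFiber V M) :=
  ⟨α, fun _ => Submodule.mem_top⟩

theorem isSmoothSubbundle_cotangentFiber :
    IsSmoothSubbundle V (V →L[ℝ] ℝ) (cotangentFiber V M) := by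
  intro x
  obtain ⟨n, φ, D, hD⟩ := exists_coordinates (V := V) x
  obtain ⟨O, hOD, hO, hx⟩ := eventually_nhds_iff.1 hD
  refine ⟨O, hO, hx, n, fun i y => differential (φ i) y,
    fun i => (differential (φ i)).contMDiff.contMDiffOn, fun y hy =>
      ⟨(hOD y hy).linearIndependent_differential, (hOD y hy).span_differential⟩⟩

/-- The cotangent Lie algebroid of a Poisson manifold. -/
def PoissonStructure.cotangentAlgebroid (ϖ : PoissonStructure V M) : CotangentAlgebroid V M where
  subbundle := isSmoothSubbundle_cotangentFiber
  anchor x := (ϖ.sharp x : Cotangent V x →ₗ[ℝ] TangentSpace 𝓘(ℝ, V) x).comp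
    (Submodule.subtype _)
  anchor_smooth s := (ϖ.field s.1).contMDiff
  bracket := LinearMap.mk₂ ℝ (fun s t => toSection (ϖ.bracket s.1 t.1))
    (fun s s' t => Subtype.ext (ϖ.bracket_add_left s.1 s'.1 t.1))
    (fun c s t => Subtype.ext (ϖ.bracket_smul_left c s.1 t.1))
    (fun s t t' => Subtype.ext (ϖ.bracket_add_right s.1 t.1 t'.1))
    (fun c s t => Subtype.ext (ϖ.bracket_smul_right c s.1 t.1))
  bracket_self s := Subtype.ext (ϖ.bracket_self s.1)
  jacobi r s t := Subtype.ext (ϖ.bracket_jacobi r.1 s.1 t.1)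
  leibniz f hf s t ft hft x := by
    obtain ⟨g, rfl⟩ : ∃ g : SmoothFunction V M, (g : M → ℝ) = f := ⟨⟨f, hf⟩, rfl⟩
    have h : ft.1 = fsmul g t.1 := by
      ext1 y
      exact congrArg Subtype.val (hft y)
    have h2 : ϖ.bracket s.1 ft.1 = _ := (congrArg (ϖ.bracket s.1) h).trans (ϖ.bracket_fsmul g _ _)
    exact Subtype.ext (DFunLike.congr_fun h2 x)
  anchor_bracket s t x := by
    have := DFunLike.congr_fun (ϖ.field_bracket s.1 t.1) x
    exact this

theorem PoissonStructure.isCotangentAlgebroid (ϖ : PoissonStructure V M) :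
    IsCotangentAlgebroid ϖ ϖ.cotangentAlgebroid where
  anchor _ _ := rfl
  bracket ξ η Y x := DFunLike.congr_fun (ϖ.pair_bracket ξ.1 η.1 Y) x

/-- Vector fields separate one-forms, so the prescribed pairings determine the bracket. Any
cotangent algebroid may then be computed with `PoissonStructure.bracket`. -/
theorem IsCotangentAlgebroid.bracket_eq {ϖ : PoissonStructure V M} {A : CotangentAlgebroid V M}
    (h : IsCotangentAlgebroid ϖ A) (ξ η : sections V (V →L[ℝ] ℝ) (cotangentFiber V M)) :
    (A.bracket ξ η).1 = ϖ.bracket ξ.1 η.1 := by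
  refine oneForm_ext fun Y => ?_
  ext x
  exact (h.bracket ξ η Y x).trans (DFunLike.congr_fun (ϖ.pair_bracket ξ.1 η.1 Y) x).symm

end CotangentAlgebroid

/-! ### The Lie algebroid of vertical vectors -/

section VerticalAlgebroid

variable {V : Type*} [NormedAddCommGroup V] [NormedSpace ℝ V] [FiniteDimensional ℝ V]
  {E : Type*} [TopologicalSpace E] [ChartedSpace V E] [IsManifold 𝓘(ℝ, V) ∞ E] [T2Space E]
  {W : Type*} [NormedAddCommGroup W] [NormedSpace ℝ W] [FiniteDimensional ℝ W]
  {X : Type*} [TopologicalSpace X] [ChartedSpace W X] [IsManifold 𝓘(ℝ, W) ∞ X] [T2Space X]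
  {p : C^∞⟮𝓘(ℝ, V), E; 𝓘(ℝ, W), X⟯}

theorem isSmoothSubbundle_verticalFiber (hp : Manifold.IsSubmersion 𝓘(ℝ, V) 𝓘(ℝ, W) ∞ p) :
    IsSmoothSubbundle V V (verticalFiber p) := by
  intro e
  obtain ⟨m, k, χ, D, Z, K, h⟩ := exists_submersion_frame hp e
  obtain ⟨O, hO, hOo, he⟩ := eventually_nhds_iff.1 h
  exact ⟨O, hOo, he, k, fun j y => K j y, fun j => (K j).contMDiff.contMDiffOn,
    fun y hy => ⟨(hO y hy).linearIndependent, (hO y hy).span⟩⟩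

theorem act_pullbackFunction_of_vertical {s : SmoothVectorField V E}
    (hs : ∀ e, s e ∈ verticalFiber p e) (f : SmoothFunction W X) :
    act s (pullbackFunction p f) = 0 := by
  ext e
  rw [act_apply, mvfderiv_pullbackFunction]
  have h : mfderiv 𝓘(ℝ, V) 𝓘(ℝ, W) p e (s e) = 0 := hs e
  rw [h]
  exact map_zero _

theorem act_zero (Y : SmoothVectorField V E) : act Y (0 : SmoothFunction V E) = 0 := by
  simpa using act_smul Y 0 (0 : SmoothFunction V E)

/-- Vertical fields annihilate all functions `f ∘ p`, hence so does their commutator; such functions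
detect `p_*` of a vector. -/
theorem lie_mem_verticalFiber {s t : SmoothVectorField V E} (hs : ∀ e, s e ∈ verticalFiber p e)
    (ht : ∀ e, t e ∈ verticalFiber p e) (e : E) : lie s t e ∈ verticalFiber p e := by
  change mfderiv 𝓘(ℝ, V) 𝓘(ℝ, W) p e (lie s t e) = 0
  refine tangent_ext fun f => ?_
  rw [← mvfderiv_pullbackFunction, map_zero]
  have h := DFunLike.congr_fun (act_lie s t (pullbackFunction p f)) e
  rw [act_pullbackFunction_of_vertical hs, act_pullbackFunction_of_vertical ht, act_zero,
    act_zero] at h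
  exact h.trans (sub_self (0 : ℝ))

/-- The Lie algebroid of vertical vectors. -/
def verticalAlgebroid (hp : Manifold.IsSubmersion 𝓘(ℝ, V) 𝓘(ℝ, W) ∞ p) :
    LieAlgebroid V V (verticalFiber p) where
  subbundle := isSmoothSubbundle_verticalFiber hp
  anchor e := (verticalFiber p e).subtype
  anchor_smooth s := s.1.contMDiff
  bracket := LinearMap.mk₂ ℝ (fun s t => ⟨lie s.1 t.1, lie_mem_verticalFiber s.2 t.2⟩)
    (fun s s' t => Subtype.ext (lie_add_left s.1 s'.1 t.1))
    (fun c s t => Subtype.ext (lie_smul_left c s.1 t.1))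
    (fun s t t' => Subtype.ext (lie_add_right s.1 t.1 t'.1))
    (fun c s t => Subtype.ext (lie_smul_right c s.1 t.1))
  bracket_self s := Subtype.ext (lie_self s.1)
  jacobi r s t := Subtype.ext (lie_jacobi r.1 s.1 t.1)
  leibniz f hf s t ft hft x := by
    obtain ⟨g, rfl⟩ : ∃ g : SmoothFunction V E, (g : E → ℝ) = f := ⟨⟨f, hf⟩, rfl⟩
    have h : ft.1 = fsmul g t.1 := by
      ext1 y
      exact congrArg Subtype.val (hft y)
    have h2 : lie s.1 ft.1 = _ := (congrArg (lie s.1) h).trans (lie_fsmul_right g _ _)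
    exact Subtype.ext (DFunLike.congr_fun h2 x)
  anchor_bracket _ _ _ := rfl

theorem isVerticalAlgebroid (hp : Manifold.IsSubmersion 𝓘(ℝ, V) 𝓘(ℝ, W) ∞ p) :
    IsVerticalAlgebroid p (verticalAlgebroid hp) where
  anchor _ _ := rfl
  bracket _ _ _ := rfl

end VerticalAlgebroid

/-! ### Cartan calculus for one-forms and a closed two-form -/

section ExteriorDerivative

variable {V : Type*} [NormedAddCommGroup V] [NormedSpace ℝ V] [FiniteDimensional ℝ V]
  {M : Type*} [TopologicalSpace M] [ChartedSpace V M] [IsManifold 𝓘(ℝ, V) ∞ M] [T2Space M]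

/-- The exterior derivative `dα(X, Y) = X(α(Y)) - Y(α(X)) - α([X, Y])`. -/
def extD (α : OneForm V M) (X Y : SmoothVectorField V M) : SmoothFunction V M :=
  act X (pair α Y) - act Y (pair α X) - pair α (lie X Y)

theorem extD_add (α β : OneForm V M) (X Y : SmoothVectorField V M) :
    extD (α + β) X Y = extD α X Y + extD β X Y := by
  simp only [extD, pair_add_left, act_add]; ring

theorem extD_fsmul (f : SmoothFunction V M) (α : OneForm V M) (X Y : SmoothVectorField V M) :
    extD (fsmul f α) X Y = f * extD α X Y + (act X f * pair α Y - act Y f * pair α X) := by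
  simp only [extD, pair_fsmul_left, act_mul]; ring

theorem extD_differential (f : SmoothFunction V M) (X Y : SmoothVectorField V M) :
    extD (differential f) X Y = 0 := by
  simp only [extD, pair_differential, act_lie]; ring

theorem extD_sum {ι : Type*} (S : Finset ι) (α : ι → OneForm V M) (X Y : SmoothVectorField V M) :
    extD (∑ i ∈ S, α i) X Y = ∑ i ∈ S, extD (α i) X Y :=
  map_sum (AddMonoidHom.mk' (fun α => extD α X Y) fun α β => extD_add α β X Y) α S

theorem extD_add_vector (α : OneForm V M) (X X' Y : SmoothVectorField V M) :
    extD α (X + X') Y = extD α X Y + extD α X' Y := by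
  simp only [extD, pair_add_right, act_add, act_add_left, lie_add_left]; ring

theorem extD_smul_vector (c : ℝ) (α : OneForm V M) (X Y : SmoothVectorField V M) :
    extD α (c • X) Y = c • extD α X Y := by
  simp only [extD, pair_smul_right, act_smul, act_smul_left, lie_smul_left, smul_sub]

theorem extD_sum_smul_vector {ι : Type*} (S : Finset ι) (α : OneForm V M) (c : ι → ℝ)
    (X : ι → SmoothVectorField V M) (Y : SmoothVectorField V M) :
    extD α (∑ i ∈ S, c i • X i) Y = ∑ i ∈ S, c i • extD α (X i) Y := by
  have := map_sum (AddMonoidHom.mk' (fun X => extD α X Y) fun X X' => extD_add_vector α X X' Y)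
    (fun i => c i • X i) S
  exact this.trans (Finset.sum_congr rfl fun i _ => extD_smul_vector _ _ _ _)

theorem act_congr {f g : SmoothFunction V M} {x : M} (h : (f : M → ℝ) =ᶠ[𝓝 x] g)
    (X : SmoothVectorField V M) : act X f x = act X g x :=
  DFunLike.congr_fun (h.mfderiv_eq (I := 𝓘(ℝ, V)) (I' := 𝓘(ℝ, ℝ))) (X x)

theorem extD_congr {α β : OneForm V M} {x : M} (h : ∀ᶠ y in 𝓝 x, α y = β y)
    (X Y : SmoothVectorField V M) : extD α X Y x = extD β X Y x := by
  have hp : ∀ Z : SmoothVectorField V M, (pair α Z : M → ℝ) =ᶠ[𝓝 x] pair β Z := fun Z => by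
    filter_upwards [h] with y hy
    rw [pair_apply, pair_apply, hy]
  change act X (pair α Y) x - act Y (pair α X) x - pair α (lie X Y) x =
    act X (pair β Y) x - act Y (pair β X) x - pair β (lie X Y) x
  rw [act_congr (hp Y), act_congr (hp X), (hp (lie X Y)).self_of_nhds]

/-- This is `d(∑ hᵢ dφᵢ) = ∑ dhᵢ ∧ dφᵢ`. The right side shows that `dα` at `x` depends on `X` and
`Y` only through their values at `x`. -/
theorem extD_eq_sum {α : OneForm V M} {x : M} {n : ℕ} {h φ : Fin n → SmoothFunction V M}
    (hα : ∀ᶠ y in 𝓝 x, α y = ∑ i, h i y • mvfderiv 𝓘(ℝ, V) (φ i) y)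
    (X Y : SmoothVectorField V M) :
    extD α X Y x = ∑ i, (act X (h i) x * act Y (φ i) x - act Y (h i) x * act X (φ i) x) := by
  have hα' : ∀ᶠ y in 𝓝 x, α y = (∑ i, fsmul (h i) (differential (φ i))) y := by
    filter_upwards [hα] with y hy
    rw [hy, section_sum_apply]
    rfl
  rw [extD_congr hα', extD_sum, smoothFunction_sum_apply]
  refine Finset.sum_congr rfl fun i _ => ?_
  rw [extD_fsmul, extD_differential, mul_zero, zero_add]
  rfl

/-- Cartan's formula turns the Lie derivatives into contractions of `dξ` and `dη`. These behave well
under pullback and need the fields at a single point only. -/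
theorem PoissonStructure.pair_bracket_eq_extD (ϖ : PoissonStructure V M) (ξ η : OneForm V M)
    (Y : SmoothVectorField V M) :
    pair (ϖ.bracket ξ η) Y =
      extD η (ϖ.field ξ) Y - extD ξ (ϖ.field η) Y - act Y (pair ξ (ϖ.field η)) := by
  rw [ϖ.pair_bracket, extD, extD, ϖ.pair_field_swap ξ η, act_neg]
  ring

/-- The one-form `σ♯ U`. -/
def TwoForm.contract (σ : TwoForm V M) (U : SmoothVectorField V M) : OneForm V M :=
  ⟨fun x => σ.sharp x (U x), ContMDiff.clm_bundle_apply (b := fun y => y)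
    (E₂ := fun x : M => Cotangent V x) σ.form.contMDiff U.contMDiff⟩

theorem TwoForm.form_swap (σ : TwoForm V M) (x : M) (u v : TangentSpace 𝓘(ℝ, V) x) :
    σ.form x u v = -σ.form x v u := by
  have h := σ.alternating x (u + v)
  have h1 := σ.alternating x u
  have h2 := σ.alternating x v
  have ha : ∀ w, σ.form x (u + v) w = σ.form x u w + σ.form x v w := fun w =>
    DFunLike.congr_fun (map_add (σ.form x) u v) w
  rw [map_add, ha, ha, h1, h2] at h
  linarith

theorem TwoForm.pair_contract_swap (σ : TwoForm V M) (U Y : SmoothVectorField V M) :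
    pair (σ.contract U) Y = -pair (σ.contract Y) U := by
  ext x
  exact σ.form_swap x (U x) (Y x)

/-- For `dσ = 0` the left side is `L_U i_T σ - i_T L_U σ`, which is `i_{[U, T]} σ`. -/
theorem TwoForm.Closed.extD_contract {σ : TwoForm V M} (hσ : σ.Closed)
    (U T Y : SmoothVectorField V M) :
    extD (σ.contract T) U Y - extD (σ.contract U) T Y - act Y (pair (σ.contract U) T) =
      pair (σ.contract (lie U T)) Y := by
  have h : act U (pair (σ.contract T) Y) + act T (pair (σ.contract Y) U)
      + act Y (pair (σ.contract U) T) - pair (σ.contract (lie U T)) Y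
      - pair (σ.contract (lie T Y)) U - pair (σ.contract (lie Y U)) T = 0 := by
    ext x
    exact hσ U T Y x
  rw [σ.pair_contract_swap (lie T Y), σ.pair_contract_swap (lie Y U), lie_swap Y U,
    σ.pair_contract_swap Y U, pair_neg_right, act_neg] at h
  simp only [extD]
  rw [σ.pair_contract_swap T U, act_neg]
  linear_combination h

end ExteriorDerivative

/-! ### Pullback of forms and the main bracket computation -/

section PullbackForm

variable {V : Type*} [NormedAddCommGroup V] [NormedSpace ℝ V] [FiniteDimensional ℝ V]
  {E : Type*} [TopologicalSpace E] [ChartedSpace V E] [IsManifold 𝓘(ℝ, V) ∞ E] [T2Space E]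
  {W : Type*} [NormedAddCommGroup W] [NormedSpace ℝ W] [FiniteDimensional ℝ W]
  {X : Type*} [TopologicalSpace X] [ChartedSpace W X] [IsManifold 𝓘(ℝ, W) ∞ X] [T2Space X]
  (p : C^∞⟮𝓘(ℝ, V), E; 𝓘(ℝ, W), X⟯)

theorem pullbackCovector_eq_sum {y : E} {n : ℕ} {h : Fin n → ℝ} {φ : Fin n → SmoothFunction W X}
    {β : Cotangent W (p y)} (hβ : β = ∑ i, h i • mvfderiv 𝓘(ℝ, W) (φ i) (p y)) :
    pullbackCovector p y β = ∑ i, h i • mvfderiv 𝓘(ℝ, V) (pullbackFunction p (φ i)) y := by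
  rw [hβ, map_sum]
  refine Finset.sum_congr rfl fun i _ => ?_
  rw [map_smul]
  congr 1
  ext v
  exact (mvfderiv_pullbackFunction p (φ i) y v).symm

theorem eventually_pullbackCovector_eq_sum {β : OneForm W X} {e : E} {n : ℕ}
    {h φ : Fin n → SmoothFunction W X}
    (hβ : ∀ᶠ x in 𝓝 (p e), β x = ∑ i, h i x • mvfderiv 𝓘(ℝ, W) (φ i) x) :
    ∀ᶠ y in 𝓝 e, pullbackCovector p y (β (p y)) =
      ∑ i, pullbackFunction p (h i) y • mvfderiv 𝓘(ℝ, V) (pullbackFunction p (φ i)) y := by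
  have hpc : ContinuousAt p e := p.contMDiff.continuous.continuousAt
  filter_upwards [hpc.eventually hβ] with y hy
  exact pullbackCovector_eq_sum p hy

/-- The pullback of a one-form. -/
def pullbackForm (β : OneForm W X) : OneForm V E :=
  ⟨fun y => pullbackCovector p y (β (p y)), fun e => by
    obtain ⟨n, h, φ, hβ⟩ := exists_oneForm_eventuallyEq_sum β (p e)
    refine ((∑ i, fsmul (pullbackFunction p (h i))
      (differential (pullbackFunction p (φ i)))).contMDiff e).congr_of_eventuallyEq ?_
    filter_upwards [eventually_pullbackCovector_eq_sum p hβ] with y hy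
    rw [hy, section_sum_apply]
    rfl⟩

theorem pullbackForm_apply_apply (β : OneForm W X) (y : E) (v : TangentSpace 𝓘(ℝ, V) y) :
    pullbackForm p β y v = β (p y) (mfderiv 𝓘(ℝ, V) 𝓘(ℝ, W) p y v) := rfl

/-- This is `d p^* = p^* d`, read off from `extD_eq_sum` and `p^*dφ = d(φ ∘ p)`. The fields need to
be `p`-related only at `e`, so no projectable fields have to be constructed. -/
theorem extD_pullbackForm (β : OneForm W X) {U Y : SmoothVectorField V E}
    {U' Y' : SmoothVectorField W X} {e : E}
    (hU : mfderiv 𝓘(ℝ, V) 𝓘(ℝ, W) p e (U e) = U' (p e))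
    (hY : mfderiv 𝓘(ℝ, V) 𝓘(ℝ, W) p e (Y e) = Y' (p e)) :
    extD (pullbackForm p β) U Y e = extD β U' Y' (p e) := by
  obtain ⟨n, h, φ, hβ⟩ := exists_oneForm_eventuallyEq_sum β (p e)
  rw [extD_eq_sum hβ, extD_eq_sum (eventually_pullbackCovector_eq_sum p hβ)]
  have hact : ∀ (f : SmoothFunction W X), act U (pullbackFunction p f) e = act U' f (p e) := by
    intro f
    rw [act_apply, mvfderiv_pullbackFunction, hU]
    rfl
  have hact' : ∀ (f : SmoothFunction W X), act Y (pullbackFunction p f) e = act Y' f (p e) := by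
    intro f
    rw [act_apply, mvfderiv_pullbackFunction, hY]
    rfl
  simp only [hact, hact']

theorem act_sum {ι : Type*} (S : Finset ι) (Y : SmoothVectorField V E)
    (f : ι → SmoothFunction V E) : act Y (∑ i ∈ S, f i) = ∑ i ∈ S, act Y (f i) :=
  map_sum (AddMonoidHom.mk' (act Y) (act_add Y)) f S

theorem extD_sum_fsmul_pullbackForm {ι : Type*} [Fintype ι] {h : ι → SmoothFunction V E}
    {β : ι → OneForm W X} {U Y : SmoothVectorField V E} {U' Y' : SmoothVectorField W X} {e : E}
    (hU : mfderiv 𝓘(ℝ, V) 𝓘(ℝ, W) p e (U e) = U' (p e))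
    (hY : mfderiv 𝓘(ℝ, V) 𝓘(ℝ, W) p e (Y e) = Y' (p e)) :
    extD (∑ j, fsmul (h j) (pullbackForm p (β j))) U Y e =
      ∑ j, (h j e * extD (β j) U' Y' (p e) +
        (act U (h j) e * pair (β j) Y' (p e) - act Y (h j) e * pair (β j) U' (p e))) := by
  rw [extD_sum, smoothFunction_sum_apply]
  refine Finset.sum_congr rfl fun j _ => ?_
  rw [extD_fsmul]
  change h j e * extD (pullbackForm p (β j)) U Y e + (act U (h j) e * pullbackForm p (β j) e (Y e)
    - act Y (h j) e * pullbackForm p (β j) e (U e)) = _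
  rw [extD_pullbackForm p (β j) hU hY, pullbackForm_apply_apply, pullbackForm_apply_apply, hU, hY]
  rfl

theorem extD_sum_smul_field (πX : PoissonStructure W X) {ι : Type*} [Fintype ι] (β : OneForm W X)
    (c : ι → ℝ) (α : ι → OneForm W X) (Y : SmoothVectorField W X) (x : X) :
    extD β (∑ i, c i • πX.field (α i)) Y x = ∑ i, c i * extD β (πX.field (α i)) Y x := by
  rw [extD_sum_smul_vector, smoothFunction_sum_apply]
  rfl

theorem pair_sum_smul_field (πX : PoissonStructure W X) {ι : Type*} [Fintype ι] (β : OneForm W X)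
    (c : ι → ℝ) (α : ι → OneForm W X) (x : X) :
    pair β (∑ i, c i • πX.field (α i)) x = ∑ i, c i * pair β (πX.field (α i)) x := by
  rw [pair_apply, section_sum_apply, map_sum]
  exact Finset.sum_congr rfl fun i _ => map_smul _ _ _

/-- The bookkeeping of the main computation: all terms with `YF` or `YG`, the derivatives of the
coefficients along the test field, cancel. Here `A` stands for `αᵢ(π♯βⱼ)`, `P` and `Q` for the
exterior derivatives of `βⱼ` and `αᵢ`, and `R` for the derivative of `A`. -/
theorem sum_bracket_rearrange {ι κ : Type*} [Fintype ι] [Fintype κ] (F VF YF a : ι → ℝ)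
    (G UG YG b : κ → ℝ) (A P Q R : ι → κ → ℝ) :
    ∑ j, (G j * ∑ i, F i * P i j + (UG j * b j - YG j * -∑ i, F i * A i j))
      - ∑ i, (F i * ∑ j, G j * Q i j + (VF i * a i - YF i * ∑ j, G j * A i j))
      - ∑ i, ∑ j, (F i * (G j * R i j + A i j * YG j) + G j * A i j * YF i) =
    ∑ i, ∑ j, F i * G j * (P i j - Q i j - R i j) + ∑ j, UG j * b j - ∑ i, VF i * a i := by
  have h1 : ∑ j, (G j * ∑ i, F i * P i j + (UG j * b j - YG j * -∑ i, F i * A i j)) =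
      ∑ i, ∑ j, (F i * G j * P i j + YG j * (F i * A i j)) + ∑ j, UG j * b j := by
    rw [Finset.sum_comm, ← Finset.sum_add_distrib]
    refine Finset.sum_congr rfl fun j _ => ?_
    have : G j * ∑ i, F i * P i j = ∑ i, F i * G j * P i j := by
      rw [Finset.mul_sum]
      exact Finset.sum_congr rfl fun i _ => by ring
    rw [Finset.sum_add_distrib, ← Finset.mul_sum, this]
    ring
  have h2 : ∑ i, (F i * ∑ j, G j * Q i j + (VF i * a i - YF i * ∑ j, G j * A i j)) =
      ∑ i, ∑ j, (F i * G j * Q i j - YF i * (G j * A i j)) + ∑ i, VF i * a i := by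
    rw [← Finset.sum_add_distrib]
    refine Finset.sum_congr rfl fun i _ => ?_
    have : F i * ∑ j, G j * Q i j = ∑ j, F i * G j * Q i j := by
      rw [Finset.mul_sum]
      exact Finset.sum_congr rfl fun j _ => by ring
    rw [Finset.sum_sub_distrib, ← Finset.mul_sum, this]
    ring
  rw [h1, h2]
  have h3 : ∑ i, ∑ j, F i * G j * (P i j - Q i j - R i j) =
      ∑ i, ∑ j, (F i * G j * P i j + YG j * (F i * A i j))
      - ∑ i, ∑ j, (F i * G j * Q i j - YF i * (G j * A i j))
      - ∑ i, ∑ j, (F i * (G j * R i j + A i j * YG j) + G j * A i j * YF i) := by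
    simp only [← Finset.sum_sub_distrib]
    exact Finset.sum_congr rfl fun i _ => Finset.sum_congr rfl fun j _ => by ring
  rw [h3]
  ring

variable {p}

/-- The bracket of `σ♯U + ∑ fᵢ p^*αᵢ` and `σ♯T + ∑ gⱼ p^*βⱼ`. -/
theorem pair_bracket_of_eventuallyEq {πX : PoissonStructure W X} {πE : PoissonStructure V E}
    {σ : TwoForm V E} (hσ : σ.Closed) {ξ η : OneForm V E} {U T : SmoothVectorField V E}
    (hU : πE.field ξ = U) (hT : πE.field η = T) {m n : ℕ}
    {f : Fin m → SmoothFunction V E} {g : Fin n → SmoothFunction V E}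
    {α : Fin m → OneForm W X} {β : Fin n → OneForm W X} {e : E}
    (hξ : ∀ᶠ y in 𝓝 e, ξ y = σ.sharp y (U y) + pullbackCovector p y (∑ i, f i y • α i (p y)))
    (hη : ∀ᶠ y in 𝓝 e, η y = σ.sharp y (T y) + pullbackCovector p y (∑ j, g j y • β j (p y)))
    (hUp : ∀ᶠ y in 𝓝 e, mfderiv 𝓘(ℝ, V) 𝓘(ℝ, W) p y (U y) =
      πX.sharp (p y) (∑ i, f i y • α i (p y)))
    (hTp : ∀ᶠ y in 𝓝 e, mfderiv 𝓘(ℝ, V) 𝓘(ℝ, W) p y (T y) =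
      πX.sharp (p y) (∑ j, g j y • β j (p y))) (Y : SmoothVectorField V E) :
    pair (πE.bracket ξ η) Y e = σ.sharp e (lie U T e) (Y e) +
      (∑ i, ∑ j, (f i e * g j e) • πX.bracket (α i) (β j) (p e)
        + ∑ j, act U (g j) e • β j (p e) - ∑ i, act T (f i) e • α i (p e))
          (mfderiv 𝓘(ℝ, V) 𝓘(ℝ, W) p e (Y e)) := by
  have hξ' : ∀ᶠ y in 𝓝 e, ξ y = (σ.contract U + ∑ i, fsmul (f i) (pullbackForm p (α i))) y := by
    filter_upwards [hξ] with y hy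
    rw [hy, map_sum, ContMDiffSection.coe_add, Pi.add_apply, section_sum_apply]
    simp only [map_smul]
    rfl
  have hη' : ∀ᶠ y in 𝓝 e, η y = (σ.contract T + ∑ j, fsmul (g j) (pullbackForm p (β j))) y := by
    filter_upwards [hη] with y hy
    rw [hy, map_sum, ContMDiffSection.coe_add, Pi.add_apply, section_sum_apply]
    simp only [map_smul]
    rfl
  -- The fields `Y'`, `U'` and `T'` on the base match `p_*Y`, `p_*U` and `p_*T` at `e` only; the
  -- coefficients of `U'` and `T'` are frozen at `e`.
  obtain ⟨Y', hY'⟩ := exists_vectorField_eq (p e) (mfderiv 𝓘(ℝ, V) 𝓘(ℝ, W) p e (Y e))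
  let U' : SmoothVectorField W X := ∑ i, f i e • πX.field (α i)
  let T' : SmoothVectorField W X := ∑ j, g j e • πX.field (β j)
  have hU' : mfderiv 𝓘(ℝ, V) 𝓘(ℝ, W) p e (U e) = U' (p e) := by
    rw [hUp.self_of_nhds, map_sum, section_sum_apply]
    simp only [map_smul]
    rfl
  have hT' : mfderiv 𝓘(ℝ, V) 𝓘(ℝ, W) p e (T e) = T' (p e) := by
    rw [hTp.self_of_nhds, map_sum, section_sum_apply]
    simp only [map_smul]
    rfl
  have hA : extD η U Y e = extD (σ.contract T) U Y e +
      ∑ j, (g j e * ∑ i, f i e * extD (β j) (πX.field (α i)) Y' (p e) +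
        (act U (g j) e * pair (β j) Y' (p e)
          - act Y (g j) e * -∑ i, f i e * pair (α i) (πX.field (β j)) (p e))) := by
    rw [extD_congr hη', extD_add]
    change extD (σ.contract T) U Y e + extD (∑ j, fsmul (g j) (pullbackForm p (β j))) U Y e = _
    rw [extD_sum_fsmul_pullbackForm p hU' hY'.symm]
    congr 1
    refine Finset.sum_congr rfl fun j _ => ?_
    rw [extD_sum_smul_field, pair_sum_smul_field, ← Finset.sum_neg_distrib]
    congr 3
    refine Finset.sum_congr rfl fun i _ => ?_
    rw [πX.pair_field_swap (α i) (β j), ← mul_neg]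
    rfl
  have hB : extD ξ T Y e = extD (σ.contract U) T Y e +
      ∑ i, (f i e * ∑ j, g j e * extD (α i) (πX.field (β j)) Y' (p e) +
        (act T (f i) e * pair (α i) Y' (p e)
          - act Y (f i) e * ∑ j, g j e * pair (α i) (πX.field (β j)) (p e))) := by
    rw [extD_congr hξ', extD_add]
    change extD (σ.contract U) T Y e + extD (∑ i, fsmul (f i) (pullbackForm p (α i))) T Y e = _
    rw [extD_sum_fsmul_pullbackForm p hT' hY'.symm]
    congr 1
    refine Finset.sum_congr rfl fun i _ => ?_
    rw [extD_sum_smul_field, pair_sum_smul_field]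
  -- This function is differentiated along `Y`, so frozen coefficients do not suffice: the relation
  -- `p_*T = ∑ gⱼ πX♯βⱼ` is used on a neighbourhood of `e`.
  have hpair : (pair ξ T : E → ℝ) =ᶠ[𝓝 e] (pair (σ.contract U) T +
      ∑ i, ∑ j, f i * (g j * pullbackFunction p (pair (α i) (πX.field (β j)))) :
        SmoothFunction V E) := by
    filter_upwards [hξ, hTp] with y hy hTy
    rw [ContMDiffMap.coe_add, Pi.add_apply, smoothFunction_sum_apply, pair_apply, hy]
    change σ.sharp y (U y) (T y) + (∑ i, f i y • α i (p y)) (mfderiv 𝓘(ℝ, V) 𝓘(ℝ, W) p y (T y)) = _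
    rw [hTy]
    congr 1
    rw [_root_.sum_apply]
    refine Finset.sum_congr rfl fun i _ => ?_
    rw [smoothFunction_sum_apply, map_sum, _root_.smul_apply, map_sum, Finset.smul_sum]
    refine Finset.sum_congr rfl fun j _ => ?_
    rw [map_smul, map_smul]
    rfl
  have hC : act Y (pair ξ T) e = act Y (pair (σ.contract U) T) e +
      ∑ i, ∑ j, (f i e * (g j e * act Y' (pair (α i) (πX.field (β j))) (p e)
        + pair (α i) (πX.field (β j)) (p e) * act Y (g j) e)
        + g j e * pair (α i) (πX.field (β j)) (p e) * act Y (f i) e) := by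
    rw [act_congr hpair, act_add, ContMDiffMap.coe_add, Pi.add_apply, act_sum,
      smoothFunction_sum_apply]
    congr 1
    refine Finset.sum_congr rfl fun i _ => ?_
    rw [act_sum, smoothFunction_sum_apply]
    refine Finset.sum_congr rfl fun j _ => ?_
    have hYp : act Y (pullbackFunction p (pair (α i) (πX.field (β j)))) e =
        act Y' (pair (α i) (πX.field (β j))) (p e) := by
      rw [act_apply, mvfderiv_pullbackFunction, ← hY']
      rfl
    rw [← hYp, act_mul, act_mul]
    rfl
  have hσ' := DFunLike.congr_fun (hσ.extD_contract U T Y) e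
  change extD (σ.contract T) U Y e - extD (σ.contract U) T Y e - act Y (pair (σ.contract U) T) e
    = σ.sharp e (lie U T e) (Y e) at hσ'
  rw [πE.pair_bracket_eq_extD, hU, hT]
  change extD η U Y e - extD ξ T Y e - act Y (pair ξ T) e = _
  have hR : (∑ i, ∑ j, (f i e * g j e) • πX.bracket (α i) (β j) (p e)
        + ∑ j, act U (g j) e • β j (p e) - ∑ i, act T (f i) e • α i (p e)) (Y' (p e)) =
      ∑ i, ∑ j, f i e * g j e * (extD (β j) (πX.field (α i)) Y' (p e)
        - extD (α i) (πX.field (β j)) Y' (p e) - act Y' (pair (α i) (πX.field (β j))) (p e))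
      + ∑ j, act U (g j) e * pair (β j) Y' (p e) - ∑ i, act T (f i) e * pair (α i) Y' (p e) := by
    have hb : ∀ i j, πX.bracket (α i) (β j) (p e) (Y' (p e)) =
        extD (β j) (πX.field (α i)) Y' (p e) - extD (α i) (πX.field (β j)) Y' (p e)
          - act Y' (pair (α i) (πX.field (β j))) (p e) := fun i j =>
      DFunLike.congr_fun (πX.pair_bracket_eq_extD (α i) (β j) Y') (p e)
    simp only [← hb]
    rw [_root_.sub_apply, _root_.add_apply, _root_.sum_apply, _root_.sum_apply, _root_.sum_apply]
    simp only [_root_.sum_apply]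
    rfl
  rw [← hY', hR, ← hσ', hA, hB, hC, ← sum_bracket_rearrange]
  ring

end PullbackForm

/-! ### Smooth sections of `TE ⊕ p^*(T*X)` -/

section AmbientBundle

variable {V : Type*} [NormedAddCommGroup V] [NormedSpace ℝ V] [FiniteDimensional ℝ V]
  {E : Type*} [TopologicalSpace E] [ChartedSpace V E] [IsManifold 𝓘(ℝ, V) ∞ E] [T2Space E]
  {W : Type*} [NormedAddCommGroup W] [NormedSpace ℝ W] [FiniteDimensional ℝ W]
  {X : Type*} [TopologicalSpace X] [ChartedSpace W X] [IsManifold 𝓘(ℝ, W) ∞ X] [T2Space X]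
  {p : C^∞⟮𝓘(ℝ, V), E; 𝓘(ℝ, W), X⟯}

theorem contMDiffAt_ambient_iff {s : Π e, ambientFiber p e} {e₀ : E} :
    ContMDiffAt 𝓘(ℝ, V) (𝓘(ℝ, V).prod 𝓘(ℝ, V × (W →L[ℝ] ℝ))) ∞
      (fun e => TotalSpace.mk' (V × (W →L[ℝ] ℝ)) e (s e)) e₀ ↔
    ContMDiffAt 𝓘(ℝ, V) (𝓘(ℝ, V).prod 𝓘(ℝ, V)) ∞
      (fun e => (TotalSpace.mk' V e (s e).1 : TangentBundle 𝓘(ℝ, V) E)) e₀ ∧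
    ContMDiffAt 𝓘(ℝ, V) (𝓘(ℝ, W).prod 𝓘(ℝ, W →L[ℝ] ℝ)) ∞
      (fun e => (TotalSpace.mk' (W →L[ℝ] ℝ) (p e) (ambientSnd p e (s e)) :
        TotalSpace (W →L[ℝ] ℝ) (fun x : X => Cotangent W x))) e₀ := by
  rw [contMDiffAt_section, contMDiffAt_section, contMDiffAt_totalSpace]
  simp only [p.contMDiff.contMDiffAt, true_and]
  exact contMDiffAt_prod_module_iff _

/-- The section `(U, β ∘ p)` of `TE ⊕ p^*(T*X)`. -/
def ambientSection (p : C^∞⟮𝓘(ℝ, V), E; 𝓘(ℝ, W), X⟯) (U : SmoothVectorField V E)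
    (β : OneForm W X) : Cₛ^∞⟮𝓘(ℝ, V); V × (W →L[ℝ] ℝ), ambientFiber p⟯ :=
  ⟨fun e => (U e, β (p e)), fun e => contMDiffAt_ambient_iff.2
    ⟨U.contMDiff e, β.contMDiff.contMDiffAt.comp e p.contMDiff.contMDiffAt⟩⟩

theorem contMDiffAt_apply_along {a : Π e, Cotangent W (p e)} {e₀ : E}
    (ha : ContMDiffAt 𝓘(ℝ, V) (𝓘(ℝ, W).prod 𝓘(ℝ, W →L[ℝ] ℝ)) ∞
      (fun e => (TotalSpace.mk' (W →L[ℝ] ℝ) (p e) (a e) :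
        TotalSpace (W →L[ℝ] ℝ) (fun x : X => Cotangent W x))) e₀) (D : SmoothVectorField W X) :
    ContMDiffAt 𝓘(ℝ, V) 𝓘(ℝ, ℝ) ∞ (fun e => a e (D (p e))) e₀ :=
  (contMDiffAt_totalSpace.1 (ContMDiffAt.clm_bundle_apply (E₂ := Bundle.Trivial X ℝ)
    (b := p) (v := fun e => D (p e)) ha
    (D.contMDiff.contMDiffAt.comp e₀ p.contMDiff.contMDiffAt))).2

/-- Here `a` is a covector field along `p`, in general not a one-form on the base. Its coefficients
in a coordinate coframe are smooth on `E`, and `p^*` sends that coframe to the differentials of `φᵢ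
∘ p`. -/
theorem contMDiffAt_pullbackCovector {a : Π e, Cotangent W (p e)} {e₀ : E}
    (ha : ContMDiffAt 𝓘(ℝ, V) (𝓘(ℝ, W).prod 𝓘(ℝ, W →L[ℝ] ℝ)) ∞
      (fun e => (TotalSpace.mk' (W →L[ℝ] ℝ) (p e) (a e) :
        TotalSpace (W →L[ℝ] ℝ) (fun x : X => Cotangent W x))) e₀) :
    ContMDiffAt 𝓘(ℝ, V) (𝓘(ℝ, V).prod 𝓘(ℝ, V →L[ℝ] ℝ)) ∞
      (fun e => (TotalSpace.mk' (V →L[ℝ] ℝ) e (pullbackCovector p e (a e)) :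
        TotalSpace (V →L[ℝ] ℝ) (fun e : E => Cotangent V e))) e₀ := by
  obtain ⟨n, φ, D, hD⟩ := exists_coordinates (V := W) (p e₀)
  have hpc : ContinuousAt p e₀ := p.contMDiff.continuous.continuousAt
  have h : ContMDiffAt 𝓘(ℝ, V) (𝓘(ℝ, V).prod 𝓘(ℝ, V →L[ℝ] ℝ)) ∞
      (fun e => (TotalSpace.mk' (V →L[ℝ] ℝ) e
        (∑ i, a e (D i (p e)) • differential (pullbackFunction p (φ i)) e) :
        TotalSpace (V →L[ℝ] ℝ) (fun e : E => Cotangent V e))) e₀ :=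
    ContMDiffAt.sum_section fun i _ => (contMDiffAt_apply_along ha (D i)).smul_section
      ((differential (pullbackFunction p (φ i))).contMDiff e₀)
  refine h.congr_of_eventuallyEq ?_
  filter_upwards [hpc.eventually hD] with e he
  congr 1
  exact pullbackCovector_eq_sum p (he.covector_eq (a e))

theorem pullbackCovector_injective {e : E}
    (h : Function.Surjective (mfderiv 𝓘(ℝ, V) 𝓘(ℝ, W) p e)) :
    Function.Injective (pullbackCovector (V := V) (W := W) p e) := by
  intro α β hαβ
  ext w
  obtain ⟨v, rfl⟩ := h w
  exact DFunLike.congr_fun hαβ v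

/-- The vector field component of a section of `TE ⊕ p^*(T*X)`. -/
def fstField (s : Cₛ^∞⟮𝓘(ℝ, V); V × (W →L[ℝ] ℝ), ambientFiber p⟯) : SmoothVectorField V E :=
  ⟨fun e => (s e).1, fun e => (contMDiffAt_ambient_iff.1 (s.contMDiff e)).1⟩

theorem contMDiff_ambientSnd (s : Cₛ^∞⟮𝓘(ℝ, V); V × (W →L[ℝ] ℝ), ambientFiber p⟯) :
    ContMDiff 𝓘(ℝ, V) (𝓘(ℝ, W).prod 𝓘(ℝ, W →L[ℝ] ℝ)) ∞
      (fun e => (TotalSpace.mk' (W →L[ℝ] ℝ) (p e) (ambientSnd p e (s e)) :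
        TotalSpace (W →L[ℝ] ℝ) (fun x : X => Cotangent W x))) :=
  fun e => (contMDiffAt_ambient_iff.1 (s.contMDiff e)).2

/-- Provides the local expansions to which the bracket rule applies; they come from a coordinate
coframe of the base. -/
theorem exists_ambientSnd_eq_sum (s : Cₛ^∞⟮𝓘(ℝ, V); V × (W →L[ℝ] ℝ), ambientFiber p⟯) (e₀ : E) :
    ∃ O : Set E, IsOpen O ∧ e₀ ∈ O ∧ ∃ (n : ℕ) (f : Fin n → SmoothFunction V E)
      (α : Fin n → OneForm W X), ∀ e ∈ O, ambientSnd p e (s e) = ∑ i, f i e • α i (p e) := by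
  obtain ⟨n, φ, D, hD⟩ := exists_coordinates (V := W) (p e₀)
  have hpc : ContinuousAt p e₀ := p.contMDiff.continuous.continuousAt
  obtain ⟨O, hO, hOo, he⟩ := eventually_nhds_iff.1 (hpc.eventually hD)
  exact ⟨O, hOo, he, n, fun i => ⟨fun e => ambientSnd p e (s e) (D i (p e)),
    fun e => contMDiffAt_apply_along (contMDiff_ambientSnd s e) (D i)⟩,
    fun i => differential (φ i), fun e heO => (hO e heO).covector_eq _⟩

end AmbientBundle

/-! ### Transport and composition of Lie algebroid structures -/

section Sections

variable {V : Type*} [NormedAddCommGroup V] [NormedSpace ℝ V]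
  {M : Type*} [TopologicalSpace M] [ChartedSpace V M] [IsManifold 𝓘(ℝ, V) ∞ M]
  {F : Type*} [NormedAddCommGroup F] [NormedSpace ℝ F]
  {B : M → Type*} [TopologicalSpace (TotalSpace F B)] [∀ x, AddCommGroup (B x)]
  [∀ x, Module ℝ (B x)] [∀ x, TopologicalSpace (B x)] [FiberBundle F B] [VectorBundle ℝ F B]
  {F' : Type*} [NormedAddCommGroup F'] [NormedSpace ℝ F']
  {B' : M → Type*} [TopologicalSpace (TotalSpace F' B')] [∀ x, AddCommGroup (B' x)]
  [∀ x, Module ℝ (B' x)] [∀ x, TopologicalSpace (B' x)] [FiberBundle F' B'] [VectorBundle ℝ F' B']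
  {F'' : Type*} [NormedAddCommGroup F''] [NormedSpace ℝ F'']
  {B'' : M → Type*} [TopologicalSpace (TotalSpace F'' B'')] [∀ x, AddCommGroup (B'' x)]
  [∀ x, Module ℝ (B'' x)] [∀ x, TopologicalSpace (B'' x)] [FiberBundle F'' B'']
  [VectorBundle ℝ F'' B'']
  {S : Π x, Submodule ℝ (B x)} {S' : Π x, Submodule ℝ (B' x)} {S'' : Π x, Submodule ℝ (B'' x)}

/-- The bundle map `φ` sends smooth sections to smooth sections. -/
def PreservesSections (V F F' : Type*) [NormedAddCommGroup V] [NormedSpace ℝ V]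
    {M : Type*} [TopologicalSpace M] [ChartedSpace V M] [IsManifold 𝓘(ℝ, V) ∞ M]
    [NormedAddCommGroup F] [NormedSpace ℝ F]
    {B : M → Type*} [TopologicalSpace (TotalSpace F B)] [∀ x, AddCommGroup (B x)]
    [∀ x, Module ℝ (B x)] [∀ x, TopologicalSpace (B x)] [FiberBundle F B] [VectorBundle ℝ F B]
    [NormedAddCommGroup F'] [NormedSpace ℝ F']
    {B' : M → Type*} [TopologicalSpace (TotalSpace F' B')] [∀ x, AddCommGroup (B' x)]
    [∀ x, Module ℝ (B' x)] [∀ x, TopologicalSpace (B' x)] [FiberBundle F' B']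
    [VectorBundle ℝ F' B']
    {S : Π x, Submodule ℝ (B x)} {S' : Π x, Submodule ℝ (B' x)}
    (φ : Π x, S x →ₗ[ℝ] S' x) : Prop :=
  ∀ s : sections V F S, ContMDiff 𝓘(ℝ, V) (𝓘(ℝ, V).prod 𝓘(ℝ, F')) ∞
    (fun x => TotalSpace.mk' F' x (φ x (secAt s x) : B' x))

/-- The induced map on sections. -/
def mapSections (φ : Π x, S x →ₗ[ℝ] S' x) (hφ : PreservesSections V F F' φ) :
    sections V F S →ₗ[ℝ] sections V F' S' where
  toFun s := ⟨⟨fun x => φ x (secAt s x), hφ s⟩, fun x => (φ x (secAt s x)).2⟩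
  map_add' s t := Subtype.ext (ContMDiffSection.ext fun x =>
    congrArg Subtype.val (map_add (φ x) (secAt s x) (secAt t x)))
  map_smul' c s := Subtype.ext (ContMDiffSection.ext fun x =>
    congrArg Subtype.val (map_smul (φ x) c (secAt s x)))

theorem secAt_mapSections (φ : Π x, S x →ₗ[ℝ] S' x) (hφ : PreservesSections V F F' φ)
    (s : sections V F S) (x : M) : secAt (mapSections φ hφ s) x = φ x (secAt s x) := rfl

theorem sections_ext {s t : sections V F S} (h : ∀ x, secAt s x = secAt t x) : s = t :=
  Subtype.ext (ContMDiffSection.ext fun x => congrArg Subtype.val (h x))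

/-- The Lie algebroid structure transported along an isomorphism of vector bundles. -/
def LieAlgebroid.transport (A' : LieAlgebroid V F' S') (hS : IsSmoothSubbundle V F S)
    (φ : Π x, S x ≃ₗ[ℝ] S' x) (hφ : PreservesSections V F F' fun x => (φ x : S x →ₗ[ℝ] S' x))
    (hψ : PreservesSections V F' F fun x => ((φ x).symm : S' x →ₗ[ℝ] S x)) :
    LieAlgebroid V F S where
  subbundle := hS
  anchor x := (A'.anchor x).comp (φ x : S x →ₗ[ℝ] S' x)
  anchor_smooth s := A'.anchor_smooth (mapSections _ hφ s)
  bracket := (A'.bracket.compl₁₂ (mapSections _ hφ) (mapSections _ hφ)).compr₂ (mapSections _ hψ)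
  bracket_self s := by
    simp only [LinearMap.compr₂_apply, LinearMap.compl₁₂_apply, A'.bracket_self, map_zero]
  jacobi r s t := by
    have hinv : ∀ u, mapSections _ hφ (mapSections _ hψ u) = u := fun u =>
      sections_ext fun x => (φ x).apply_symm_apply _
    simp only [LinearMap.compr₂_apply, LinearMap.compl₁₂_apply, hinv, ← map_add, A'.jacobi,
      map_zero]
  leibniz f hf s t ft hft x := by
    have h := A'.leibniz f hf (mapSections _ hφ s) (mapSections _ hφ t) (mapSections _ hφ ft)
      (fun y => by rw [secAt_mapSections, hft, map_smul]; rfl) x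
    have h2 := congrArg (φ x).symm h
    rw [map_add, map_smul, map_smul] at h2
    refine h2.trans ?_
    congr 2
    exact (φ x).symm_apply_apply _
  anchor_bracket s t x := by
    have h := A'.anchor_bracket (mapSections _ hφ s) (mapSections _ hφ t) x
    refine Eq.trans ?_ h
    exact congrArg (A'.anchor x) ((φ x).apply_symm_apply _)

theorem IsLieAlgebroidHom.comp {A : LieAlgebroid V F S} {A' : LieAlgebroid V F' S'}
    {A'' : LieAlgebroid V F'' S''} {φ : Π x, S x →ₗ[ℝ] S' x} {χ : Π x, S' x →ₗ[ℝ] S'' x}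
    (hχ : IsLieAlgebroidHom A' A'' χ) (hφ : IsLieAlgebroidHom A A' φ) :
    IsLieAlgebroidHom A A'' (fun x => (χ x).comp (φ x)) where
  smooth s := hχ.smooth (mapSections φ hφ.smooth s)
  anchor x u := (hχ.anchor x (φ x u)).trans (hφ.anchor x u)
  bracket s t s' t' hs ht x := by
    rw [hχ.bracket (mapSections φ hφ.smooth s) (mapSections φ hφ.smooth t) s' t' hs ht x,
      hφ.bracket s t _ _ (fun _ => rfl) (fun _ => rfl) x]
    rfl

variable {W : Type*} [NormedAddCommGroup W] [NormedSpace ℝ W]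
  {N : Type*} [TopologicalSpace N] [ChartedSpace W N] [IsManifold 𝓘(ℝ, W) ∞ N]
  {G : Type*} [NormedAddCommGroup G] [NormedSpace ℝ G]
  {C : N → Type*} [TopologicalSpace (TotalSpace G C)] [∀ x, AddCommGroup (C x)]
  [∀ x, Module ℝ (C x)] [∀ x, TopologicalSpace (C x)] [FiberBundle G C] [VectorBundle ℝ G C]

theorem IsLieAlgebroidHomOver.comp {p : M → N} {T : Π x, Submodule ℝ (C x)}
    {A : LieAlgebroid V F S} {A' : LieAlgebroid V F' S'} {D : LieAlgebroid W G T}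
    {φ : Π x, S x →ₗ[ℝ] S' x} {j : Π x, S' x →ₗ[ℝ] T (p x)}
    (hj : IsLieAlgebroidHomOver p A' D j) (hφ : IsLieAlgebroidHom A A' φ) :
    IsLieAlgebroidHomOver p A D (fun x => (j x).comp (φ x)) where
  smooth s := hj.smooth (mapSections φ hφ.smooth s)
  anchor x u := by
    rw [← hφ.anchor]
    exact hj.anchor x (φ x u)
  bracket s t := by
    have h := hj.bracket (mapSections φ hφ.smooth s) (mapSections φ hφ.smooth t)
    have ha : ∀ (u : sections V F S) (x : M),
        A'.anchor x (secAt (mapSections φ hφ.smooth u) x) = A.anchor x (secAt u x) :=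
      fun u x => hφ.anchor x (secAt u x)
    have hb := hφ.bracket s t (mapSections φ hφ.smooth s) (mapSections φ hφ.smooth t)
      (fun _ => rfl) (fun _ => rfl)
    simp only [ha, hb] at h
    exact h

theorem IsLieAlgebroidHom.symm {A : LieAlgebroid V F S} {A' : LieAlgebroid V F' S'}
    {φ : Π x, S x ≃ₗ[ℝ] S' x} (hφ : IsLieAlgebroidHom A A' fun x => (φ x : S x →ₗ[ℝ] S' x))
    (hψ : PreservesSections V F' F fun x => ((φ x).symm : S' x →ₗ[ℝ] S x)) :
    IsLieAlgebroidHom A' A fun x => ((φ x).symm : S' x →ₗ[ℝ] S x) where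
  smooth := hψ
  anchor x u := by
    refine (hφ.anchor x ((φ x).symm u)).symm.trans ?_
    exact congrArg (A'.anchor x) ((φ x).apply_symm_apply u)
  bracket s t s' t' hs ht x := by
    apply (φ x).injective
    refine (hφ.bracket s' t' s t (fun y => ?_) (fun y => ?_) x).symm.trans
      ((φ x).apply_symm_apply _).symm
    · rw [hs]; exact ((φ y).apply_symm_apply _).symm
    · rw [ht]; exact ((φ y).apply_symm_apply _).symm

end Sections

theorem linearIndependent_and_span_of_equiv {A B ι : Type*} [AddCommGroup A] [Module ℝ A]
    [AddCommGroup B] [Module ℝ B] {S : Submodule ℝ A} {T : Submodule ℝ B} (ψ : S ≃ₗ[ℝ] T)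
    (b : ι → S) (hb : LinearIndependent ℝ fun i => (b i : A))
    (hs : Submodule.span ℝ (Set.range fun i => (b i : A)) = S) :
    LinearIndependent ℝ (fun i => (ψ (b i) : B)) ∧
      Submodule.span ℝ (Set.range fun i => (ψ (b i) : B)) = T := by
  have hb' : LinearIndependent ℝ b := LinearIndependent.of_comp S.subtype hb
  have hs' : Submodule.span ℝ (Set.range b) = ⊤ := by
    apply Submodule.map_injective_of_injective S.injective_subtype
    rw [Submodule.map_span, Submodule.map_top, Submodule.range_subtype, ← Set.range_comp]
    exact hs
  refine ⟨(hb'.map' (ψ : S →ₗ[ℝ] T) ψ.ker).map' T.subtype T.ker_subtype, ?_⟩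
  have h : (Set.range fun i => (ψ (b i) : B)) =
      (T.subtype ∘ₗ (ψ : S →ₗ[ℝ] T)) '' Set.range b := by
    rw [← Set.range_comp]; rfl
  rw [h, ← Submodule.map_span, hs', Submodule.map_top, LinearMap.range_comp, ψ.range,
    Submodule.map_top, Submodule.range_subtype]

/-! ### The bundle isomorphism given by the gauge transformation -/

section GaugeIsomorphism

variable {V : Type*} [NormedAddCommGroup V] [NormedSpace ℝ V] [FiniteDimensional ℝ V]
  {E : Type*} [TopologicalSpace E] [ChartedSpace V E] [IsManifold 𝓘(ℝ, V) ∞ E] [T2Space E]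
  {W : Type*} [NormedAddCommGroup W] [NormedSpace ℝ W] [FiniteDimensional ℝ W]
  {X : Type*} [TopologicalSpace X] [ChartedSpace W X] [IsManifold 𝓘(ℝ, W) ∞ X] [T2Space X]
  {πX : PoissonStructure W X} {p : C^∞⟮𝓘(ℝ, V), E; 𝓘(ℝ, W), X⟯} {σ : TwoForm V E}
  {πE : PoissonStructure V E}

theorem sharpAddPullback_coe (e : E) (u : pullbackFiber p πX e) :
    (sharpAddPullback p πX σ e u).1 =
      σ.sharp e u.1.1 + pullbackCovector p e (ambientSnd p e u.1) := rfl

theorem mfderiv_fst_pullbackFiber {e : E} (u : pullbackFiber p πX e) :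
    mfderiv 𝓘(ℝ, V) 𝓘(ℝ, W) p e u.1.1 = πX.sharp (p e) (ambientSnd p e u.1) := u.2

/-- Membership of `U + (σ♯U + p^*η)` in the graph of `πE` is exactly this equation. It yields
compatibility with anchors and recovers `U` from the image. -/
theorem sharp_sharpAddPullback
    (hπE : ∀ e, gaugeDirac σ (pullbackDirac p πX.graph) e = πE.graph e) (e : E)
    (u : pullbackFiber p πX e) : πE.sharp e (sharpAddPullback p πX σ e u).1 = u.1.1 := by
  have h : ((u.1.1, (sharpAddPullback p πX σ e u).1) :
      TangentSpace 𝓘(ℝ, V) e × Cotangent V e) ∈ πE.graph e := by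
    rw [← hπE e]
    refine ⟨(u.1.1, pullbackCovector p e (ambientSnd p e u.1)),
      ⟨(u.1.1, ambientSnd p e u.1), ⟨ambientSnd p e u.1, ?_⟩, rfl⟩, ?_⟩
    · exact Prod.ext (mfderiv_fst_pullbackFiber u).symm rfl
    · exact Prod.ext rfl (add_comm _ _)
  obtain ⟨ξ, hξ⟩ := h
  have h1 : πE.sharp e ξ = u.1.1 := congrArg Prod.fst hξ
  have h2 : ξ = (sharpAddPullback p πX σ e u).1 := congrArg Prod.snd hξ
  rw [← h2, h1]

/-- The inclusion of the gauge-transformed Dirac structure in the graph gives injectivity, together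
with injectivity of `p^*`; the reverse inclusion gives surjectivity. -/
theorem sharpAddPullback_bijective
    (hπE : ∀ e, gaugeDirac σ (pullbackDirac p πX.graph) e = πE.graph e) {e : E}
    (hp : Function.Surjective (mfderiv 𝓘(ℝ, V) 𝓘(ℝ, W) p e)) :
    Function.Bijective (sharpAddPullback p πX σ e) := by
  constructor
  · intro u u' h
    have h1 : u.1.1 = u'.1.1 := by
      rw [← sharp_sharpAddPullback hπE e u, h, sharp_sharpAddPullback hπE e u']
    have h2 := congrArg Subtype.val h
    rw [sharpAddPullback_coe, sharpAddPullback_coe, h1] at h2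
    exact Subtype.ext (Prod.ext h1 (pullbackCovector_injective hp (add_left_cancel h2)))
  · intro ξ
    have h : ((πE.sharp e ξ.1, ξ.1) : TangentSpace 𝓘(ℝ, V) e × Cotangent V e) ∈
        gaugeDirac σ (pullbackDirac p πX.graph) e := by
      rw [hπE e]
      exact ⟨ξ.1, rfl⟩
    obtain ⟨_, ⟨⟨U, a⟩, ⟨a', ha'⟩, rfl⟩, h3⟩ := h
    have h4 : a' = a := congrArg Prod.snd ha'
    have h5 : πX.sharp (p e) a' = mfderiv 𝓘(ℝ, V) 𝓘(ℝ, W) p e U := congrArg Prod.fst ha'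
    have h6 : pullbackCovector p e a + σ.sharp e U = ξ.1 := congrArg Prod.snd h3
    refine ⟨⟨(U, a), ?_⟩, Subtype.ext ?_⟩
    · rw [h4] at h5
      exact h5.symm
    · exact (add_comm _ _).trans h6

/-- The isomorphism `TE ×_{TX} T*X ≃ T*E`, fibrewise. -/
def gaugeEquiv (hπE : ∀ e, gaugeDirac σ (pullbackDirac p πX.graph) e = πE.graph e)
    (hp : Manifold.IsSubmersion 𝓘(ℝ, V) 𝓘(ℝ, W) ∞ p) (e : E) :
    pullbackFiber p πX e ≃ₗ[ℝ] cotangentFiber V E e :=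
  LinearEquiv.ofBijective (sharpAddPullback p πX σ e)
    (sharpAddPullback_bijective hπE (mfderiv_surjective_of_isSubmersion hp e))

variable (hπE : ∀ e, gaugeDirac σ (pullbackDirac p πX.graph) e = πE.graph e)
  (hp : Manifold.IsSubmersion 𝓘(ℝ, V) 𝓘(ℝ, W) ∞ p)

theorem gaugeEquiv_symm_fst (e : E) (ξ : cotangentFiber V E e) :
    ((gaugeEquiv hπE hp e).symm ξ).1.1 = πE.sharp e ξ.1 := by
  have h := sharp_sharpAddPullback hπE e ((gaugeEquiv hπE hp e).symm ξ)
  have h2 : sharpAddPullback p πX σ e ((gaugeEquiv hπE hp e).symm ξ) = ξ :=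
    (gaugeEquiv hπE hp e).apply_symm_apply ξ
  rw [h2] at h
  exact h.symm

theorem pullbackCovector_gaugeEquiv_symm (e : E) (ξ : cotangentFiber V E e) :
    pullbackCovector p e (ambientSnd p e ((gaugeEquiv hπE hp e).symm ξ).1) =
      ξ.1 - σ.sharp e (πE.sharp e ξ.1) := by
  have h2 : sharpAddPullback p πX σ e ((gaugeEquiv hπE hp e).symm ξ) = ξ :=
    (gaugeEquiv hπE hp e).apply_symm_apply ξ
  have h3 := congrArg Subtype.val h2
  rw [sharpAddPullback_coe, gaugeEquiv_symm_fst] at h3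
  exact eq_sub_of_add_eq' h3

theorem preservesSections_sharpAddPullback :
    PreservesSections V (V × (W →L[ℝ] ℝ)) (V →L[ℝ] ℝ) (sharpAddPullback p πX σ) := fun s e =>
  ContMDiffAt.add_section ((σ.contract (fstField s.1)).contMDiff e)
    (contMDiffAt_pullbackCovector (contMDiff_ambientSnd s.1 e))

/-- The first component of the inverse is `πE♯ξ`. The second is known only through its pullback `τ =
ξ - σ♯(πE♯ξ)`, but its coefficients in the coframe `dχ` are `τ(Z l)`, as `Z l` lifts the dual frame;
these are smooth. -/
theorem preservesSections_gaugeEquiv_symm :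
    PreservesSections V (V →L[ℝ] ℝ) (V × (W →L[ℝ] ℝ))
      (fun e => ((gaugeEquiv hπE hp e).symm : cotangentFiber V E e →ₗ[ℝ] pullbackFiber p πX e)) := by
  intro ξ e₀
  obtain ⟨m, k, χ, D, Z, K, hF⟩ := exists_submersion_frame hp e₀
  let τ : OneForm V E := ξ.1 - σ.contract (πE.field ξ.1)
  let t : Cₛ^∞⟮𝓘(ℝ, V); V × (W →L[ℝ] ℝ), ambientFiber p⟯ :=
    ambientSection p (πE.field ξ.1) 0 +
      ∑ l, fsmul (pair τ (Z l)) (ambientSection p 0 (differential (χ l)))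
  refine (t.contMDiff e₀).congr_of_eventuallyEq ?_
  filter_upwards [hF] with e he
  congr 1
  change ((gaugeEquiv hπE hp e).symm (secAt ξ e)).1 = t e
  have ht : t e = ambientSection p (πE.field ξ.1) 0 e +
      ∑ l, pair τ (Z l) e • ambientSection p 0 (differential (χ l)) e := by
    rw [ContMDiffSection.coe_add, Pi.add_apply, section_sum_apply]
    rfl
  rw [ht]
  refine Prod.ext ?_ ?_
  · rw [gaugeEquiv_symm_fst, Prod.fst_add, Prod.fst_sum]
    have : ∀ l, (pair τ (Z l) e • ambientSection p 0 (differential (χ l)) e).1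
        = (0 : TangentSpace 𝓘(ℝ, V) e) := fun l => smul_zero _
    simp only [this, Finset.sum_const_zero]
    exact (add_zero _).symm
  · have h1 := pullbackCovector_gaugeEquiv_symm hπE hp e (secAt ξ e)
    have h2 := he.base.covector_eq (ambientSnd p e ((gaugeEquiv hπE hp e).symm (secAt ξ e)).1)
    have h3 : ∀ l, ambientSnd p e ((gaugeEquiv hπE hp e).symm (secAt ξ e)).1 (D l (p e))
        = pair τ (Z l) e := by
      intro l
      rw [← he.lift l]
      exact DFunLike.congr_fun h1 (Z l e)
    simp only [h3] at h2
    have h4 : ambientSnd p e (ambientSection p (πE.field ξ.1) 0 e +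
        ∑ l, pair τ (Z l) e • ambientSection p 0 (differential (χ l)) e) =
        ∑ l, pair τ (Z l) e • differential (χ l) (p e) := by
      rw [map_add, map_sum]
      simp only [map_smul]
      exact zero_add (∑ l, pair τ (Z l) e • differential (χ l) (p e))
    exact h2.trans h4.symm

/-- Local frames are the images of coordinate coframes of `E` under the inverse isomorphism. -/
theorem isSmoothSubbundle_pullbackFiber
    (hπE : ∀ e, gaugeDirac σ (pullbackDirac p πX.graph) e = πE.graph e)
    (hp : Manifold.IsSubmersion 𝓘(ℝ, V) 𝓘(ℝ, W) ∞ p) :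
    IsSmoothSubbundle V (V × (W →L[ℝ] ℝ)) (pullbackFiber p πX) := by
  intro x
  obtain ⟨n, φ, D, hD⟩ := exists_coordinates (V := V) x
  obtain ⟨O, hOD, hO, hx⟩ := eventually_nhds_iff.1 hD
  refine ⟨O, hO, hx, n, fun i e =>
    (gaugeEquiv hπE hp e).symm (secAt (toSection (differential (φ i))) e),
    fun i => ContMDiff.contMDiffOn
      (preservesSections_gaugeEquiv_symm hπE hp (toSection (differential (φ i)))), fun e he => ?_⟩
  refine linearIndependent_and_span_of_equiv (gaugeEquiv hπE hp e).symm
    (fun i => secAt (toSection (differential (φ i))) e) ?_ ?_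
  · exact (hOD e he).linearIndependent_differential
  · exact (hOD e he).span_differential

end GaugeIsomorphism

/-! ### The pullback Lie algebroid and part 1 -/

section PullbackAlgebroid

variable {V : Type*} [NormedAddCommGroup V] [NormedSpace ℝ V] [FiniteDimensional ℝ V]
  {E : Type*} [TopologicalSpace E] [ChartedSpace V E] [IsManifold 𝓘(ℝ, V) ∞ E] [T2Space E]
  {W : Type*} [NormedAddCommGroup W] [NormedSpace ℝ W] [FiniteDimensional ℝ W]
  {X : Type*} [TopologicalSpace X] [ChartedSpace W X] [IsManifold 𝓘(ℝ, W) ∞ X] [T2Space X]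
  {πX : PoissonStructure W X} {p : C^∞⟮𝓘(ℝ, V), E; 𝓘(ℝ, W), X⟯} {σ : TwoForm V E}
  {πE : PoissonStructure V E}

theorem field_eq_fstField
    (hπE : ∀ e, gaugeDirac σ (pullbackDirac p πX.graph) e = πE.graph e)
    {s : sections V (V × (W →L[ℝ] ℝ)) (pullbackFiber p πX)} {ξ : OneForm V E}
    (hξ : ∀ e, ξ e = (sharpAddPullback p πX σ e (secAt s e)).1) : πE.field ξ = fstField s.1 := by
  ext e
  refine (congrArg (πE.sharp e) (hξ e)).trans ?_
  exact sharp_sharpAddPullback hπE e (secAt s e)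

/-- The bracket rule allows coefficients that are smooth on `O` only, whereas the calculus above
uses global functions; replacing germs changes neither values nor derivatives at `e`. -/
theorem exists_smoothFunction_family {ι : Type*} [Finite ι] {O : Set E} (hO : IsOpen O) {e : E}
    (he : e ∈ O) {f : ι → E → ℝ} (hf : ∀ i, ContMDiffOn 𝓘(ℝ, V) 𝓘(ℝ, ℝ) ∞ (f i) O) :
    ∃ f' : ι → SmoothFunction V E, (∀ᶠ y in 𝓝 e, ∀ i, f' i y = f i y) ∧
      ∀ i, mvfderiv 𝓘(ℝ, V) (f' i) e = mvfderiv 𝓘(ℝ, V) (f i) e := by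
  choose f' hf' using fun i => exists_smoothFunction_eventuallyEq hO he (hf i)
  exact ⟨f', eventually_all.2 hf', fun i =>
    (hf' i).mfderiv_eq (I := 𝓘(ℝ, V)) (I' := 𝓘(ℝ, ℝ))⟩

/-- The right side is `σ♯ + p^*` applied to the bracket prescribed on the fibre product. No
algebroid on the fibre product is assumed, so the formula serves both its construction and the
comparison with a given one. -/
theorem bracket_sharpAddPullback (hσ : σ.Closed)
    (hπE : ∀ e, gaugeDirac σ (pullbackDirac p πX.graph) e = πE.graph e)
    {s t : sections V (V × (W →L[ℝ] ℝ)) (pullbackFiber p πX)} {ξ η : OneForm V E}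
    (hξ : ∀ e, ξ e = (sharpAddPullback p πX σ e (secAt s e)).1)
    (hη : ∀ e, η e = (sharpAddPullback p πX σ e (secAt t e)).1)
    {O : Set E} (hO : IsOpen O) {m n : ℕ} {f : Fin m → E → ℝ} {g : Fin n → E → ℝ}
    {α : Fin m → OneForm W X} {β : Fin n → OneForm W X}
    (hf : ∀ i, ContMDiffOn 𝓘(ℝ, V) 𝓘(ℝ, ℝ) ∞ (f i) O)
    (hg : ∀ j, ContMDiffOn 𝓘(ℝ, V) 𝓘(ℝ, ℝ) ∞ (g j) O)
    (ha : ∀ e ∈ O, ambientSnd p e (s.1 e) = ∑ i, f i e • α i (p e))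
    (hb : ∀ e ∈ O, ambientSnd p e (t.1 e) = ∑ j, g j e • β j (p e)) {e : E} (he : e ∈ O) :
    πE.bracket ξ η e = σ.sharp e (lie (fstField s.1) (fstField t.1) e) + pullbackCovector p e
      (∑ i, ∑ j, (f i e * g j e) • πX.bracket (α i) (β j) (p e)
        + ∑ j, mvfderiv 𝓘(ℝ, V) (g j) e (fstField s.1 e) • β j (p e)
        - ∑ i, mvfderiv 𝓘(ℝ, V) (f i) e (fstField t.1 e) • α i (p e)) := by
  obtain ⟨f', hf', hdf⟩ := exists_smoothFunction_family hO he hf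
  obtain ⟨g', hg', hdg⟩ := exists_smoothFunction_family hO he hg
  have ha' : ∀ᶠ y in 𝓝 e, ambientSnd p y (s.1 y) = ∑ i, f' i y • α i (p y) := by
    filter_upwards [hf', hO.mem_nhds he] with y h1 h2
    simp only [h1]
    exact ha y h2
  have hb' : ∀ᶠ y in 𝓝 e, ambientSnd p y (t.1 y) = ∑ j, g' j y • β j (p y) := by
    filter_upwards [hg', hO.mem_nhds he] with y h1 h2
    simp only [h1]
    exact hb y h2
  refine cotangent_ext fun Y => ?_
  have key := pair_bracket_of_eventuallyEq hσ (field_eq_fstField hπE hξ)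
    (field_eq_fstField hπE hη) (f := f') (g := g') (α := α) (β := β) (e := e)
    (ha'.mono fun y hy => by rw [← hy]; exact hξ y) (hb'.mono fun y hy => by rw [← hy]; exact hη y)
    (ha'.mono fun y hy => by rw [← hy]; exact mfderiv_fst_pullbackFiber (secAt s y))
    (hb'.mono fun y hy => by rw [← hy]; exact mfderiv_fst_pullbackFiber (secAt t y)) Y
  simp only [act_apply, hdf, hdg, fun i => hf'.self_of_nhds i, fun j => hg'.self_of_nhds j] at key
  exact key

theorem bracketRule_of_eq {AX : CotangentAlgebroid W X} (hAX : IsCotangentAlgebroid πX AX)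
    {U T : Π e : E, TangentSpace 𝓘(ℝ, V) e} {a b c : Π e : E, Cotangent W (p e)}
    (h : ∀ O : Set E, IsOpen O → ∀ (m n : ℕ) (f : Fin m → E → ℝ) (g : Fin n → E → ℝ)
      (α : Fin m → OneForm W X) (β : Fin n → OneForm W X),
      (∀ i, ContMDiffOn 𝓘(ℝ, V) 𝓘(ℝ, ℝ) ∞ (f i) O) →
      (∀ j, ContMDiffOn 𝓘(ℝ, V) 𝓘(ℝ, ℝ) ∞ (g j) O) →
      (∀ e ∈ O, a e = ∑ i, f i e • α i (p e)) → (∀ e ∈ O, b e = ∑ j, g j e • β j (p e)) →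
      ∀ e ∈ O, c e = ∑ i, ∑ j, (f i e * g j e) • πX.bracket (α i) (β j) (p e)
        + ∑ j, mvfderiv 𝓘(ℝ, V) (g j) e (U e) • β j (p e)
        - ∑ i, mvfderiv 𝓘(ℝ, V) (f i) e (T e) • α i (p e)) :
    BracketRule (C := fun x : X => Cotangent W x) p AX U T a b c := by
  intro O hO m n f g α β hf hg ha hb e he
  have := h O hO m n f g (fun i => (α i).1) (fun j => (β j).1) hf hg ha hb e he
  simp only [← hAX.bracket_eq] at this
  exact this

/-- The pullback to `E` of the cotangent Lie algebroid of `X`, obtained by transport of the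
cotangent Lie algebroid of the gauge-transformed Poisson structure. -/
def pullbackAlgebroid (hπE : ∀ e, gaugeDirac σ (pullbackDirac p πX.graph) e = πE.graph e)
    (hp : Manifold.IsSubmersion 𝓘(ℝ, V) 𝓘(ℝ, W) ∞ p) : PullbackAlgebroid p πX :=
  πE.cotangentAlgebroid.transport (isSmoothSubbundle_pullbackFiber hπE hp) (gaugeEquiv hπE hp)
    preservesSections_sharpAddPullback (preservesSections_gaugeEquiv_symm hπE hp)

theorem isPullbackAlgebroid_pullbackAlgebroid (hσ : σ.Closed)
    (hπE : ∀ e, gaugeDirac σ (pullbackDirac p πX.graph) e = πE.graph e)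
    (hp : Manifold.IsSubmersion 𝓘(ℝ, V) 𝓘(ℝ, W) ∞ p) {AX : CotangentAlgebroid W X}
    (hAX : IsCotangentAlgebroid πX AX) :
    IsPullbackAlgebroid p πX AX (pullbackAlgebroid hπE hp) := by
  have hfst : ∀ (s t : sections V (V × (W →L[ℝ] ℝ)) (pullbackFiber p πX)) (e : E),
      (((pullbackAlgebroid hπE hp).bracket s t).1 e).1 = lie (fstField s.1) (fstField t.1) e := by
    intro s t e
    let ξ := mapSections (sharpAddPullback p πX σ) preservesSections_sharpAddPullback s
    let η := mapSections (sharpAddPullback p πX σ) preservesSections_sharpAddPullback t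
    have h1 : (((pullbackAlgebroid hπE hp).bracket s t).1 e).1 =
        πE.sharp e (πE.bracket ξ.1 η.1 e) :=
      gaugeEquiv_symm_fst hπE hp e (secAt (toSection (πE.bracket ξ.1 η.1)) e)
    have h2 : πE.field (πE.bracket ξ.1 η.1) = lie (fstField s.1) (fstField t.1) := by
      rw [πE.field_bracket, field_eq_fstField hπE (s := s) (fun _ => rfl),
        field_eq_fstField hπE (s := t) (fun _ => rfl)]
    exact h1.trans (DFunLike.congr_fun h2 e)
  refine ⟨fun e u => sharp_sharpAddPullback hπE e u, hfst, fun s t => ?_⟩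
  refine bracketRule_of_eq hAX fun O hO m n f g α β hf hg ha hb e he => ?_
  let ξ := mapSections (sharpAddPullback p πX σ) preservesSections_sharpAddPullback s
  let η := mapSections (sharpAddPullback p πX σ) preservesSections_sharpAddPullback t
  have h1 := bracket_sharpAddPullback hσ hπE (s := s) (t := t) (ξ := ξ.1) (η := η.1)
    (fun _ => rfl) (fun _ => rfl) hO hf hg ha hb he
  have h2 : sharpAddPullback p πX σ e (secAt ((pullbackAlgebroid hπE hp).bracket s t) e) =
      secAt (toSection (πE.bracket ξ.1 η.1)) e := (gaugeEquiv hπE hp e).apply_symm_apply _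
  have h3 : σ.sharp e (lie (fstField s.1) (fstField t.1) e) + pullbackCovector p e
      (ambientSnd p e (((pullbackAlgebroid hπE hp).bracket s t).1 e)) = πE.bracket ξ.1 η.1 e := by
    rw [← hfst s t e]
    exact congrArg Subtype.val h2
  -- The first components agree, so the `σ♯`-terms cancel and injectivity of `p^*` isolates the
  -- second component.
  exact pullbackCovector_injective (mfderiv_surjective_of_isSubmersion hp e)
    (add_left_cancel (h3.trans h1))

theorem isLieAlgebroidHom_sharpAddPullback (hσ : σ.Closed)
    (hπE : ∀ e, gaugeDirac σ (pullbackDirac p πX.graph) e = πE.graph e)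
    {AX : CotangentAlgebroid W X} {AE : CotangentAlgebroid V E} {P : PullbackAlgebroid p πX}
    (hAX : IsCotangentAlgebroid πX AX) (hAE : IsCotangentAlgebroid πE AE)
    (hP : IsPullbackAlgebroid p πX AX P) :
    IsLieAlgebroidHom P AE (sharpAddPullback p πX σ) where
  smooth := preservesSections_sharpAddPullback
  anchor e u := by
    rw [hAE.anchor, hP.anchor]
    exact sharp_sharpAddPullback hπE e u
  bracket s t ξ η hξ hη e := by
    obtain ⟨O, hO, he, m, f, α, ha⟩ := exists_ambientSnd_eq_sum s.1 e
    obtain ⟨O', hO', he', n, g, β, hb⟩ := exists_ambientSnd_eq_sum t.1 e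
    have hf : ∀ i, ContMDiffOn 𝓘(ℝ, V) 𝓘(ℝ, ℝ) ∞ (f i) (O ∩ O') :=
      fun i => (f i).contMDiff.contMDiffOn
    have hg : ∀ j, ContMDiffOn 𝓘(ℝ, V) 𝓘(ℝ, ℝ) ∞ (g j) (O ∩ O') :=
      fun j => (g j).contMDiff.contMDiffOn
    have h1 := bracket_sharpAddPullback hσ hπE (fun y => congrArg Subtype.val (hξ y))
      (fun y => congrArg Subtype.val (hη y)) (hO.inter hO') hf hg (fun y hy => ha y hy.1)
      (fun y hy => hb y hy.2) ⟨he, he'⟩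
    have h2 := hP.bracket_snd s t (O ∩ O') (hO.inter hO') m n (fun i => f i) (fun j => g j)
      (fun i => toSection (α i)) (fun j => toSection (β j)) hf hg (fun y hy => ha y hy.1)
      (fun y hy => hb y hy.2) e ⟨he, he'⟩
    have h3 : ∀ i j, (secAt (AX.bracket (toSection (α i)) (toSection (β j))) (p e) :
        Cotangent W (p e)) = πX.bracket (α i) (β j) (p e) :=
      fun i j => DFunLike.congr_fun (hAX.bracket_eq _ _) (p e)
    simp only [h3] at h2
    refine Subtype.ext ?_
    have h4 : (AE.bracket ξ η).1 e = πE.bracket ξ.1 η.1 e :=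
      DFunLike.congr_fun (hAE.bracket_eq ξ η) e
    refine h4.trans (h1.trans ?_)
    refine congrArg₂ (· + ·) (congrArg (σ.sharp e) (hP.bracket_fst s t e).symm)
      (congrArg (pullbackCovector p e) h2.symm)

theorem isLieAlgebroidIso_sharpAddPullback (hσ : σ.Closed)
    (hπE : ∀ e, gaugeDirac σ (pullbackDirac p πX.graph) e = πE.graph e)
    (hp : Manifold.IsSubmersion 𝓘(ℝ, V) 𝓘(ℝ, W) ∞ p)
    {AX : CotangentAlgebroid W X} {AE : CotangentAlgebroid V E} {P : PullbackAlgebroid p πX}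
    (hAX : IsCotangentAlgebroid πX AX) (hAE : IsCotangentAlgebroid πE AE)
    (hP : IsPullbackAlgebroid p πX AX P) :
    IsLieAlgebroidIso P AE (sharpAddPullback p πX σ) :=
  have h := isLieAlgebroidHom_sharpAddPullback hσ hπE hAX hAE hP
  ⟨h, fun e => (gaugeEquiv hπE hp e).symm, fun e u => (gaugeEquiv hπE hp e).symm_apply_apply u,
    fun e u => (gaugeEquiv hπE hp e).apply_symm_apply u,
    IsLieAlgebroidHom.symm (φ := gaugeEquiv hπE hp) h (preservesSections_gaugeEquiv_symm hπE hp)⟩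

end PullbackAlgebroid

/-! ### The two short exact sequences and part 2 -/

section ShortExact

variable {V : Type*} [NormedAddCommGroup V] [NormedSpace ℝ V] [FiniteDimensional ℝ V]
  {E : Type*} [TopologicalSpace E] [ChartedSpace V E] [IsManifold 𝓘(ℝ, V) ∞ E] [T2Space E]
  {W : Type*} [NormedAddCommGroup W] [NormedSpace ℝ W] [FiniteDimensional ℝ W]
  {X : Type*} [TopologicalSpace X] [ChartedSpace W X] [IsManifold 𝓘(ℝ, W) ∞ X] [T2Space X]
  {πX : PoissonStructure W X} {p : C^∞⟮𝓘(ℝ, V), E; 𝓘(ℝ, W), X⟯} {σ : TwoForm V E}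
  {πE : PoissonStructure V E}

theorem sharpAddPullback_verticalInclusion (e : E) (v : verticalFiber p e) :
    sharpAddPullback p πX σ e (verticalInclusion p πX e v) = sharpVertical p σ e v :=
  Subtype.ext ((congrArg (σ.sharp e v.1 + ·) (map_zero (pullbackCovector p e))).trans
    (add_zero _))

theorem isLieAlgebroidHom_verticalInclusion {AX : CotangentAlgebroid W X}
    {P : PullbackAlgebroid p πX} {A : LieAlgebroid V V (verticalFiber p)}
    (hP : IsPullbackAlgebroid p πX AX P) (hA : IsVerticalAlgebroid p A) :
    IsLieAlgebroidHom A P (verticalInclusion p πX) where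
  smooth s := (ambientSection p s.1 0).contMDiff
  anchor e v := by
    rw [hP.anchor, hA.anchor]
    rfl
  bracket s t s' t' hs ht e := by
    have hs1 : (fun y => (s'.1 y).1) = s.1 := funext fun y => congrArg (fun u => u.1.1) (hs y)
    have ht1 : (fun y => (t'.1 y).1) = t.1 := funext fun y => congrArg (fun u => u.1.1) (ht y)
    have hs2 : ∀ y, ambientSnd p y (s'.1 y) = 0 :=
      fun y => congrArg (fun u => ambientSnd p y u.1) (hs y)
    have ht2 : ∀ y, ambientSnd p y (t'.1 y) = 0 :=
      fun y => congrArg (fun u => ambientSnd p y u.1) (ht y)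
    have h1 := hP.bracket_fst s' t' e
    rw [hs1, ht1] at h1
    -- The second components vanish, hence are empty combinations; the bracket rule then makes the
    -- second component of the bracket an empty sum.
    have h2 := hP.bracket_snd s' t' Set.univ isOpen_univ 0 0 Fin.elim0 Fin.elim0 Fin.elim0
      Fin.elim0 (fun i => i.elim0) (fun i => i.elim0)
      (fun y _ => (hs2 y).trans Finset.sum_empty.symm)
      (fun y _ => (ht2 y).trans Finset.sum_empty.symm) e (Set.mem_univ e)
    simp only [Finset.univ_eq_empty, Finset.sum_empty, add_zero, sub_zero] at h2
    exact Subtype.ext (Prod.ext (h1.trans (hA.bracket s t e).symm) h2)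

theorem isLieAlgebroidHomOver_pullbackProjection {AX : CotangentAlgebroid W X}
    {P : PullbackAlgebroid p πX} (hAX : IsCotangentAlgebroid πX AX)
    (hP : IsPullbackAlgebroid p πX AX P) :
    IsLieAlgebroidHomOver p P AX (pullbackProjection p πX) where
  smooth s := contMDiff_ambientSnd s.1
  anchor e u := by
    rw [hAX.anchor, hP.anchor]
    exact u.2.symm
  bracket s t := by
    simp only [hP.anchor]
    exact hP.bracket_snd s t

theorem isShortExact_pullback (hp : Manifold.IsSubmersion 𝓘(ℝ, V) 𝓘(ℝ, W) ∞ p)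
    {AX : CotangentAlgebroid W X} {P : PullbackAlgebroid p πX}
    {A : LieAlgebroid V V (verticalFiber p)} (hAX : IsCotangentAlgebroid πX AX)
    (hP : IsPullbackAlgebroid p πX AX P) (hA : IsVerticalAlgebroid p A) :
    IsShortExact p A P AX (verticalInclusion p πX) (pullbackProjection p πX) where
  hom_left := isLieAlgebroidHom_verticalInclusion hP hA
  hom_right := isLieAlgebroidHomOver_pullbackProjection hAX hP
  injective e v v' h := Subtype.ext (congrArg (fun u => u.1.1) h)
  exact e u := by
    constructor
    · intro h
      have h2 : ambientSnd p e u.1 = 0 := congrArg Subtype.val h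
      have h1 : mfderiv 𝓘(ℝ, V) 𝓘(ℝ, W) p e u.1.1 = 0 := by
        rw [mfderiv_fst_pullbackFiber, h2, map_zero]
      exact ⟨⟨u.1.1, h1⟩, Subtype.ext (Prod.ext rfl h2.symm)⟩
    · rintro ⟨v, rfl⟩
      rfl
  surjective e η := by
    obtain ⟨U, hU⟩ := mfderiv_surjective_of_isSubmersion hp e (πX.sharp (p e) η.1)
    exact ⟨⟨(U, η.1), hU⟩, rfl⟩

/-- The first sequence transported along `σ♯ + p^*`: the map `q` is the projection after the inverse
isomorphism, and `σ♯` on vertical vectors is the isomorphism after the inclusion. -/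
theorem isShortExact_gauge (hσ : σ.Closed)
    (hπE : ∀ e, gaugeDirac σ (pullbackDirac p πX.graph) e = πE.graph e)
    (hp : Manifold.IsSubmersion 𝓘(ℝ, V) 𝓘(ℝ, W) ∞ p)
    {AX : CotangentAlgebroid W X} {AE : CotangentAlgebroid V E} {P : PullbackAlgebroid p πX}
    {A : LieAlgebroid V V (verticalFiber p)}
    (hAX : IsCotangentAlgebroid πX AX) (hAE : IsCotangentAlgebroid πE AE)
    (hP : IsPullbackAlgebroid p πX AX P) (hA : IsVerticalAlgebroid p A) :
    IsShortExact p A AE AX (sharpVertical p σ)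
      (fun e => (pullbackProjection p πX e).comp
        ((gaugeEquiv hπE hp e).symm : cotangentFiber V E e →ₗ[ℝ] pullbackFiber p πX e)) := by
  have h := isShortExact_pullback hp hAX hP hA
  have hφ := isLieAlgebroidHom_sharpAddPullback hσ hπE hAX hAE hP
  have hi : sharpVertical p σ =
      fun e => (sharpAddPullback p πX σ e).comp (verticalInclusion p πX e) := by
    funext e
    ext1 v
    exact (sharpAddPullback_verticalInclusion e v).symm
  rw [hi]
  refine ⟨hφ.comp h.hom_left, h.hom_right.comp (IsLieAlgebroidHom.symm (φ := gaugeEquiv hπE hp) hφ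
    (preservesSections_gaugeEquiv_symm hπE hp)), fun e => ?_, fun e ξ => ?_, fun e => ?_⟩
  · exact (gaugeEquiv hπE hp e).injective.comp (h.injective e)
  · refine (h.exact e ((gaugeEquiv hπE hp e).symm ξ)).trans ⟨?_, ?_⟩
    · rintro ⟨v, hv⟩
      exact ⟨v, (congrArg (gaugeEquiv hπE hp e) hv).trans ((gaugeEquiv hπE hp e).apply_symm_apply ξ)⟩
    · rintro ⟨v, rfl⟩
      exact ⟨v, ((gaugeEquiv hπE hp e).symm_apply_apply _).symm⟩
  · exact (h.surjective e).comp (gaugeEquiv hπE hp e).symm.surjective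

end ShortExact

end

end PoissonGeometry

/-! ### The main theorem -/

theorem mainTheorem5
    {V : Type*} [NormedAddCommGroup V] [NormedSpace ℝ V] [FiniteDimensional ℝ V]
    {E : Type*} [TopologicalSpace E] [ChartedSpace V E] [IsManifold 𝓘(ℝ, V) ∞ E]
    [T2Space E] [SecondCountableTopology E]
    {W : Type*} [NormedAddCommGroup W] [NormedSpace ℝ W] [FiniteDimensional ℝ W]
    {X : Type*} [TopologicalSpace X] [ChartedSpace W X] [IsManifold 𝓘(ℝ, W) ∞ X]
    [T2Space X] [SecondCountableTopology X]
    (πX : PoissonStructure W X)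
    (p : C^∞⟮𝓘(ℝ, V), E; 𝓘(ℝ, W), X⟯)
    (hp : Manifold.IsSubmersion 𝓘(ℝ, V) 𝓘(ℝ, W) ∞ p) (hp' : Function.Surjective p)
    (σ : TwoForm V E) (hσ : σ.Closed)
    (πE : PoissonStructure V E)
    (hπE : ∀ e, gaugeDirac σ (pullbackDirac p πX.graph) e = πE.graph e) :
    (∃ (AX : CotangentAlgebroid W X) (AE : CotangentAlgebroid V E)
        (P : PullbackAlgebroid p πX) (A𝕍 : LieAlgebroid V V (verticalFiber p)),
      IsCotangentAlgebroid πX AX ∧ IsCotangentAlgebroid πE AE ∧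
        IsPullbackAlgebroid p πX AX P ∧ IsVerticalAlgebroid p A𝕍) ∧
    ∀ (AX : CotangentAlgebroid W X) (AE : CotangentAlgebroid V E)
        (P : PullbackAlgebroid p πX) (A𝕍 : LieAlgebroid V V (verticalFiber p)),
      IsCotangentAlgebroid πX AX → IsCotangentAlgebroid πE AE →
      IsPullbackAlgebroid p πX AX P → IsVerticalAlgebroid p A𝕍 →
      IsLieAlgebroidIso P AE (sharpAddPullback p πX σ) ∧
      IsShortExact p A𝕍 P AX (verticalInclusion p πX) (pullbackProjection p πX) ∧
      ∃ q : Π e, cotangentFiber V E e →ₗ[ℝ] cotangentFiber W X (p e),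
        (∀ e ξ η, q e ξ = η ↔
          pullbackCovector p e η.1 = ξ.1 - σ.sharp e (πE.sharp e ξ.1)) ∧
        IsShortExact p A𝕍 AE AX (sharpVertical p σ) q ∧
        (∀ e v, sharpAddPullback p πX σ e (verticalInclusion p πX e v) = sharpVertical p σ e v) ∧
        (∀ e u, q e (sharpAddPullback p πX σ e u) = pullbackProjection p πX e u) := by
  refine ⟨⟨πX.cotangentAlgebroid, πE.cotangentAlgebroid, pullbackAlgebroid hπE hp,
    verticalAlgebroid hp, πX.isCotangentAlgebroid, πE.isCotangentAlgebroid,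
    isPullbackAlgebroid_pullbackAlgebroid hσ hπE hp πX.isCotangentAlgebroid,
    isVerticalAlgebroid hp⟩, fun AX AE P A𝕍 hAX hAE hP hA => ?_⟩
  refine ⟨isLieAlgebroidIso_sharpAddPullback hσ hπE hp hAX hAE hP,
    isShortExact_pullback hp hAX hP hA, _, fun e ξ η => ?_,
    isShortExact_gauge hσ hπE hp hAX hAE hP hA, sharpAddPullback_verticalInclusion,
    fun e u => ?_⟩
  -- The right side becomes `p^*` of the second component of the inverse, so uniqueness of `q ξ` is
  -- injectivity of `p^*`.
  · rw [← pullbackCovector_gaugeEquiv_symm hπE hp]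
    refine ⟨fun h => ?_, fun h => Subtype.ext ?_⟩
    · rw [← h]
      rfl
    · exact (pullbackCovector_injective (mfderiv_surjective_of_isSubmersion hp e) h).symm
  · exact congrArg (pullbackProjection p πX e) ((gaugeEquiv hπE hp e).symm_apply_apply u)
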